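/- Let $a<\nu_1\le x_0\le\nu_2$ be real numbers and let $f,g$ be continuous real functions on $(a,+\infty)$. Consider the system $$\dot x=y,\qquad \dot y=-f(x)y-g(x) \tag{S}$$ in the phase space $\Pi=\{(x,y): x>a,\ y\in\mathbb R\}$. Assume that 1. $\lim_{x\to a+}g(x)=-\infty$, $\lim_{x\to+\infty}g(x)=+\infty$ and $\lim_{x\to a+}\int_{x_0}^{x}g(z)\,dz=\lim_{x\to+\infty}\int_{x_0}^{x}g(z)\,dz=+\infty$; 2. $f(x)>0$ for all $x\in(a,\nu_1)\cup(\nu_2,+\infty)$, and $\int_{\nu_2}^{\nu_1}f(x)\,dx\le 0$ (that is, $\int_{\nu_1}^{\nu_2}f(x)\,dx\ge 0$). Then there are numbers $\mu_1\in(a,\nu_1)$ and $\mu_2>\nu_2$ and a simple closed piecewise continuously differentiable curve in $\Pi$ which meets the line $\{y=0\}$ exactly at $(\mu_1,0)$ and $(\mu_2,0)$, goes from $(\mu_1,0)$ to $(\mu_2,0)$ through $\{y>0\}$ and back through $\{y<0\}$, and is transversal to (S): at every point of each of its finitely many arcs, endpoints included, the (one-sided) tangent vector of the curve and the vector field of (S)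 are linearly independent, and the vector field always points to the inner side of the curve. If, in addition, (S) has exactly one equilibrium in $\Pi$ and this equilibrium is an unstable focus, then (S) has a cycle in $\Pi$, i.e. a nonconstant periodic solution. Here an equilibrium $p$ is called an unstable focus if for all points $q\ne p$ in some neighbourhood of $p$ the trajectory through $q$ tends to $p$ as $t\to-\infty$ while its polar angle about $p$ is unbounded, tending to infinity in absolute value. -/

import Mathlib

open Set Filter Topology

/-- The vector field of the system `ẋ = y`, `ẏ = -f(x) y - g(x)`. -/
def lienardField (f g : ℝ → ℝ) (p : ℝ × ℝ) : ℝ × ℝ :=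
  (p.2, -f p.1 * p.2 - g p.1)

/-- `γ` is a solution of the system on the time set `I`, staying in the phase space
`{(x, y) : x > a}`. -/
def IsSolutionOn (a : ℝ) (f g : ℝ → ℝ) (I : Set ℝ) (γ : ℝ → ℝ × ℝ) : Prop :=
  ∀ t ∈ I, a < (γ t).1 ∧ HasDerivWithinAt γ (lienardField f g (γ t)) I t

/-- Equilibria of the system in the phase space `{(x, y) : x > a}`. -/
def IsEquilibrium (a : ℝ) (f g : ℝ → ℝ) (p : ℝ × ℝ) : Prop :=
  a < p.1 ∧ lienardField f g p = 0

/-- A cycle: a nonconstant periodic solution that lies in the phase space `{(x, y) : x > a}`. -/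
def IsCycle (a : ℝ) (f g : ℝ → ℝ) (γ : ℝ → ℝ × ℝ) : Prop :=
  IsSolutionOn a f g univ γ ∧ (∃ T : ℝ, 0 < T ∧ Function.Periodic γ T) ∧ ∃ t, γ t ≠ γ 0

/-- `p` is an unstable focus: an equilibrium such that the trajectory through every other point
near `p` tends to `p` as `t → -∞`, while its polar angle about `p` tends to infinity in absolute
value (infinitely many turns about `p`). -/
structure IsUnstableFocus (a : ℝ) (f g : ℝ → ℝ) (p : ℝ × ℝ) : Prop where
  equilibrium : IsEquilibrium a f g p
  spiral : ∃ δ : ℝ, 0 < δ ∧ ∀ q : ℝ × ℝ, q ≠ p → dist q p < δ →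
    ∃ (γ : ℝ → ℝ × ℝ) (θ : ℝ → ℝ),
      IsSolutionOn a f g (Iic 0) γ ∧ γ 0 = q ∧ Tendsto γ atBot (𝓝 p) ∧
      ContinuousOn θ (Iic 0) ∧
      (∀ t ≤ 0, ∃ r : ℝ, 0 < r ∧ γ t = p + r • (Real.cos (θ t), Real.sin (θ t))) ∧
      Tendsto (fun t => |θ t|) atBot atTop

/-- Stability of the equilibrium `p` in the sense of Lyapunov. -/
def IsLyapunovStable (a : ℝ) (f g : ℝ → ℝ) (p : ℝ × ℝ) : Prop :=
  ∀ ε : ℝ, 0 < ε → ∃ δ : ℝ, 0 < δ ∧ ∀ (T : ℝ) (γ : ℝ → ℝ × ℝ), 0 ≤ T →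
    IsSolutionOn a f g (Icc 0 T) γ → dist (γ 0) p < δ → ∀ t ∈ Icc 0 T, dist (γ t) p < ε

/-- An unstable focus is unstable in the sense of Lyapunov. -/
theorem IsUnstableFocus.not_isLyapunovStable {a : ℝ} {f g : ℝ → ℝ} {p : ℝ × ℝ}
    (h : IsUnstableFocus a f g p) : ¬ IsLyapunovStable a f g p := by
  intro hs
  obtain ⟨δ, hδ, H⟩ := h.spiral
  set q : ℝ × ℝ := p + (δ / 2, 0) with hq
  have hd : dist q p = δ / 2 := by
    rw [hq, dist_eq_norm, add_sub_cancel_left, Prod.norm_def]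
    simp [abs_of_pos hδ]
    positivity
  have hne : q ≠ p := by
    intro h0
    rw [h0, dist_self] at hd
    linarith
  obtain ⟨γ, θ, hsol, h0, hlim, -⟩ := H q hne (by linarith)
  obtain ⟨η, hη, K⟩ := hs (δ / 2) (by linarith)
  have hev : ∀ᶠ t in atBot, dist (γ t) p < η := hlim (Metric.ball_mem_nhds p hη)
  obtain ⟨t₀, ht₀, ht₁⟩ := (hev.and (eventually_le_atBot (0 : ℝ))).exists
  have hK := K (-t₀) (fun s => γ (s + t₀)) (by linarith) (by
    intro s hsI
    have hmaps : MapsTo (fun s : ℝ => s + t₀) (Icc 0 (-t₀)) (Iic 0) := by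
      intro u hu
      have := hu.2
      simp only [mem_Iic]
      linarith
    obtain ⟨hpos, hder⟩ := hsol (s + t₀) (hmaps hsI)
    refine ⟨hpos, ?_⟩
    have h1 : HasDerivWithinAt (fun s : ℝ => s + t₀) 1 (Icc 0 (-t₀)) s :=
      (hasDerivWithinAt_id s _).add_const t₀
    have h2 := HasDerivWithinAt.scomp s hder h1 hmaps
    rw [one_smul] at h2
    exact h2)
    (by simpa using ht₀) (-t₀) ⟨by linarith, le_refl _⟩
  simp only [neg_add_cancel, h0, hd, lt_self_iff_false] at hK

/-- `c : [0, 1] → {(x, y) : x > a}` is a simple closed piecewise-smooth curve (finitely many arcs,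
each continuously differentiable up to its endpoints) which is transversal to the system: on every
arc, its endpoints included, the tangent vector `c'` and the field are linearly independent (so
`c' ≠ 0`), and all trajectories cross the curve in the same direction, namely towards the
right-hand side of `c` (the inside, when `c` is traversed clockwise). -/
structure IsTransversalClosedCurve (a : ℝ) (f g : ℝ → ℝ) (c : ℝ → ℝ × ℝ) : Prop where
  continuousOn : ContinuousOn c (Icc 0 1)
  closed : c 0 = c 1
  simple : InjOn c (Ico 0 1)
  mem_phase : ∀ s ∈ Icc (0 : ℝ) 1, a < (c s).1
  arcs : ∃ (n : ℕ) (t : Fin (n + 1) → ℝ), StrictMono t ∧ t 0 = 0 ∧ t (Fin.last n) = 1 ∧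
    ∀ i : Fin n,
      ContDiffOn ℝ 1 c (Icc (t i.castSucc) (t i.succ)) ∧
      ∀ s ∈ Icc (t i.castSucc) (t i.succ),
        (derivWithin c (Icc (t i.castSucc) (t i.succ)) s).1 * (lienardField f g (c s)).2 -
          (derivWithin c (Icc (t i.castSucc) (t i.succ)) s).2 * (lienardField f g (c s)).1 < 0

/-! The closed curve is a level set `(y - s)² + 2V = M²`. Fix `n₁ < ν₁` and `n₂ > ν₂` such that `g <
0` up to `n₁` and `g > 0` from `n₂` on. Then `Φ = ∫ f` over `[n₁, n₂]` is positive, so for small `ε`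
one can let the shift `s` run from `ε` at `n₁` to `-ε` at `n₂` with `s' = κ - f`, where `κ > 0` is
the mean of `f` lowered by `2ε / (n₂ - n₁)`. Along the flow, half the left-hand side has derivative
`-(y - s)(κ y + g)` over the middle, negative on `y = s ± M` for large `M`. On the left, where the
shift is kept equal to `ε`, it is `-f y (y - ε) + ε g ≤ ε² f / 4 + ε g < 0`, and the right is
symmetric. The divergence of the potential closes the curve inside the phase space.

For the cycle, `f` and `g` are only continuous, so neither uniqueness nor continuous dependence is
used. Upper half-orbits are described by the energy `e = y² / 2` as a function of `x`, with `e' = -f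
√(2e) - g`. Always taking the maximal solution starting at `(x, 0)` makes the half-return map
antitone, though perhaps discontinuous (`BarrierData.exists_half_return`). The transversal curve
bounds these orbits from outside. From inside they are bounded by one turn of the focus, chosen so
that its successive crossings of the axis to the left of the focus do not move inwards
(`IsUnstableFocus.exists_loop`).

The central symmetry turns the lower half-plane into an upper one (`BarrierData.reflect`). Composing
the two antitone maps gives a monotone self-map of an interval, which has a fixed point by the
Knaster–Tarski argument. The two half-orbits through it form a cycle once time is recovered from `dt
= dx / y`. -/

/-! ### First-zero comparison on an interval. -/

/-- Just before its first zero `d` would be positive, against the assumption. No derivative is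
required, so the lemma also applies to the polar angle of a spiral, which is only continuous. -/
theorem pos_on_Icc_of_frequently_nonpos {d : ℝ → ℝ} {α β : ℝ} (hd : ContinuousOn d (Icc α β))
    (h0 : 0 < d α) (h : ∀ t ∈ Ioc α β, d t = 0 → ∃ᶠ u in 𝓝[<] t, d u ≤ 0) :
    ∀ t ∈ Icc α β, 0 < d t := by
  intro t ht
  by_contra hneg
  push Not at hneg
  set S : Set ℝ := Icc α t ∩ d ⁻¹' Iic 0 with hS
  have hcont : ContinuousOn d (Icc α t) := hd.mono (Icc_subset_Icc_right ht.2)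
  have hSc : IsClosed S := hcont.preimage_isClosed_of_isClosed isClosed_Icc isClosed_Iic
  have hSb : BddBelow S := ⟨α, fun x hx => hx.1.1⟩
  have hmem := hSc.csInf_mem ⟨t, ⟨ht.1, le_rfl⟩, hneg⟩ hSb
  set z := sInf S with hz
  have hbelow : ∀ u ∈ Ico α z, 0 < d u := by
    intro u hu
    by_contra hc
    exact absurd (csInf_le hSb ⟨⟨hu.1, hu.2.le.trans hmem.1.2⟩, not_lt.1 hc⟩) (not_le.2 hu.2)
  have hzα : α < z := lt_of_le_of_ne hmem.1.1 fun e => by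
    have := hmem.2
    rw [← e] at this
    exact absurd h0 (not_lt.2 this)
  have hev : ∀ᶠ u in 𝓝[<] z, 0 < d u := by
    filter_upwards [Ico_mem_nhdsLT hzα] with u hu using hbelow u hu
  have hz0 : d z = 0 := by
    refine le_antisymm hmem.2 ?_
    have ht1 : Tendsto d (𝓝[<] z) (𝓝 (d z)) :=
      (hd z ⟨hzα.le, hmem.1.2.trans ht.2⟩).mono_left
        (nhdsWithin_le_of_mem (mem_of_superset (Ico_mem_nhdsLT hzα)
          fun u hu => ⟨hu.1, hu.2.le.trans (hmem.1.2.trans ht.2)⟩))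
    exact ge_of_tendsto ht1 (hev.mono fun u hu => hu.le)
  obtain ⟨u, hu1, hu2⟩ := ((h z ⟨hzα, hmem.1.2.trans ht.2⟩ hz0).and_eventually hev).exists
  linarith

theorem HasDerivWithinAt.eventually_lt_left {d : ℝ → ℝ} {t d' : ℝ} {s : Set ℝ}
    (h : HasDerivWithinAt d d' s t) (hs : s ∈ 𝓝[<] t) (hd' : 0 < d') :
    ∀ᶠ u in 𝓝[<] t, d u < d t := by
  have h1 := (hasDerivWithinAt_iff_tendsto_slope' (s := Iio t) (by simp)).1
    (h.mono_of_mem_nhdsWithin hs)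
  filter_upwards [h1.eventually (lt_mem_nhds hd'), self_mem_nhdsWithin] with u hu hut
  have hut' : u < t := hut
  rw [slope_def_field] at hu
  have h2 : u - t < 0 := by linarith
  rcases div_pos_iff.1 hu with h3 | h3 <;> linarith [h3.1, h3.2]

theorem HasDerivWithinAt.eventually_gt_right {d : ℝ → ℝ} {t d' : ℝ} {s : Set ℝ}
    (h : HasDerivWithinAt d d' s t) (hs : s ∈ 𝓝[>] t) (hd' : 0 < d') :
    ∀ᶠ u in 𝓝[>] t, d t < d u := by
  have h1 := (hasDerivWithinAt_iff_tendsto_slope' (s := Ioi t) (by simp)).1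
    (h.mono_of_mem_nhdsWithin hs)
  filter_upwards [h1.eventually (lt_mem_nhds hd'), self_mem_nhdsWithin] with u hu hut
  have hut' : t < u := hut
  rw [slope_def_field] at hu
  have h2 : 0 < u - t := by linarith
  rcases div_pos_iff.1 hu with h3 | h3 <;> linarith [h3.1, h3.2]

theorem pos_on_Icc_of_deriv_pos {d : ℝ → ℝ} {α β : ℝ} (hd : ContinuousOn d (Icc α β))
    (h0 : 0 < d α)
    (h : ∀ t ∈ Ioc α β, d t = 0 → ∃ d', 0 < d' ∧ HasDerivWithinAt d d' (Icc α β) t) :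
    ∀ t ∈ Icc α β, 0 < d t := by
  refine pos_on_Icc_of_frequently_nonpos hd h0 fun t ht hz => ?_
  obtain ⟨d', hd', hder⟩ := h t ht hz
  refine ((hder.eventually_lt_left (mem_of_superset (Ico_mem_nhdsLT ht.1)
    fun u hu => ⟨hu.1, hu.2.le.trans ht.2⟩) hd').mono fun u hu => ?_).frequently
  linarith

/-- The variant for a start at zero: the positive derivative there pushes `d` above zero at once.
Orbits leaving the axis `y = 0` begin this way. -/
theorem pos_on_Ioc_of_deriv_pos {d : ℝ → ℝ} {α β : ℝ} (hd : ContinuousOn d (Icc α β))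
    (h0 : 0 ≤ d α)
    (h : ∀ t ∈ Icc α β, d t = 0 → ∃ d', 0 < d' ∧ HasDerivWithinAt d d' (Icc α β) t) :
    ∀ t ∈ Ioc α β, 0 < d t := by
  intro t ht
  have hαβ : α < β := ht.1.trans_le ht.2
  have hev : ∀ᶠ u in 𝓝[>] α, 0 < d u := by
    rcases h0.lt_or_eq with h1 | h1
    · have : Tendsto d (𝓝[>] α) (𝓝 (d α)) :=
        (hd α ⟨le_rfl, hαβ.le⟩).mono_left (nhdsWithin_le_of_mem (Icc_mem_nhdsGT hαβ))
      exact this.eventually (lt_mem_nhds h1)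
    · obtain ⟨d', hd', hder⟩ := h α ⟨le_rfl, hαβ.le⟩ h1.symm
      filter_upwards [hder.eventually_gt_right (Icc_mem_nhdsGT hαβ) hd'] with u hu
      linarith
  obtain ⟨u, hu0, hu1⟩ := (hev.and (Ioc_mem_nhdsGT ht.1)).exists
  refine pos_on_Icc_of_deriv_pos (hd.mono (Icc_subset_Icc_left hu1.1.le)) hu0
    (fun v hv hv0 => ?_) t ⟨hu1.2, ht.2⟩
  obtain ⟨d', hd', hder⟩ := h v ⟨hu1.1.le.trans hv.1.le, hv.2⟩ hv0
  exact ⟨d', hd', hder.mono (Icc_subset_Icc_left hu1.1.le)⟩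

/-! ### Maximal solutions by Lipschitz approximation. -/

/-- A solution of a bounded, Lipschitz scalar differential equation on a whole interval. -/
theorem exists_solution_of_lipschitz {ψ : ℝ → ℝ → ℝ} {x₁ b C : ℝ} {K : NNReal} (hb : x₁ ≤ b)
    (e₀ : ℝ)
    (hcont : ∀ e, Continuous fun x => ψ x e) (hbound : ∀ x ∈ Icc x₁ b, ∀ e, |ψ x e| ≤ C)
    (hlip : ∀ x ∈ Icc x₁ b, LipschitzWith K (ψ x)) :
    ∃ E : ℝ → ℝ, E x₁ = e₀ ∧ ∀ x ∈ Icc x₁ b, HasDerivWithinAt E (ψ x (E x)) (Icc x₁ b) x := by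
  have hC : 0 ≤ C := (abs_nonneg _).trans (hbound x₁ ⟨le_rfl, hb⟩ 0)
  have hP : IsPicardLindelof ψ (⟨x₁, le_rfl, hb⟩ : Icc x₁ b) e₀
      ⟨C * (b - x₁), mul_nonneg hC (by linarith)⟩ 0 ⟨C, hC⟩ K :=
    { lipschitzOnWith := fun t ht => (hlip t ht).lipschitzOnWith
      continuousOn := fun e _ => (hcont e).continuousOn
      norm_le := fun t ht e _ => hbound t ht e
      mul_max_le := by
        have : max (b - x₁) 0 = b - x₁ := max_eq_left (by linarith)
        simp only [this, sub_self, NNReal.coe_zero, sub_zero]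
        exact le_refl (C * (b - x₁)) }
  exact hP.exists_eq_forall_mem_Icc_hasDerivWithinAt₀

/-- A solution that is a decreasing limit of strict supersolutions, hence the maximal one. -/
theorem exists_maximal_solution_of_approx {φ : ℝ → ℝ → ℝ} {ψ : ℕ → ℝ → ℝ → ℝ} {x₁ b C : ℝ}
    {K : ℕ → NNReal} (hb : x₁ ≤ b)
    (hψ : ∀ n, Continuous (Function.uncurry (ψ n))) (hφ : Continuous (Function.uncurry φ))
    (hbound : ∀ n, ∀ x ∈ Icc x₁ b, ∀ e, |ψ n x e| ≤ C)
    (hlip : ∀ n, ∀ x ∈ Icc x₁ b, LipschitzWith (K n) (ψ n x))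
    (hdecr : ∀ n x e, ψ (n + 1) x e < ψ n x e) (hgt : ∀ n x e, φ x e < ψ n x e)
    (hlim : ∀ x (u : ℕ → ℝ) e, Tendsto u atTop (𝓝 e) →
      Tendsto (fun n => ψ n x (u n)) atTop (𝓝 (φ x e))) :
    ∃ (e : ℝ → ℝ) (E : ℕ → ℝ → ℝ), e x₁ = 0 ∧
      (∀ x ∈ Icc x₁ b, HasDerivWithinAt e (φ x (e x)) (Icc x₁ b) x) ∧
      (∀ n, ∀ x ∈ Icc x₁ b, e x < E n x) ∧
      (∀ n, ∀ x ∈ Icc x₁ b, ∃ D, φ x (E n x) < D ∧ HasDerivWithinAt (E n) D (Icc x₁ b) x) ∧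
      ∀ x ∈ Icc x₁ b, Tendsto (fun n => E n x) atTop (𝓝 (e x)) := by
  have hC : 0 ≤ C := (abs_nonneg _).trans (hbound 0 x₁ ⟨le_rfl, hb⟩ 0)
  have hx₁ : x₁ ∈ Icc x₁ b := ⟨le_rfl, hb⟩
  -- The initial values `1 / (n + 1)` decrease strictly, as do the right-hand sides, so `E (n + 1)`
  -- can never catch up with `E n`.
  choose E hE0 hE using fun n => exists_solution_of_lipschitz (ψ := ψ n) hb (1 / ((n : ℝ) + 1))
    (fun e => (hψ n).comp (by fun_prop : Continuous fun x : ℝ => (x, e))) (hbound n) (hlip n)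
  have hEc : ∀ n, ContinuousOn (E n) (Icc x₁ b) := fun n x hx => (hE n x hx).continuousWithinAt
  have hEdecr : ∀ n, ∀ x ∈ Icc x₁ b, E (n + 1) x < E n x := by
    intro n x hx
    have := pos_on_Icc_of_deriv_pos (d := fun x => E n x - E (n + 1) x)
      ((hEc n).sub (hEc (n + 1))) (by
        simp only [hE0]
        have h := one_div_lt_one_div_of_lt (Nat.cast_add_one_pos n)
          (by push_cast; linarith : (n : ℝ) + 1 < ((n + 1 : ℕ) : ℝ) + 1)
        linarith) (by
        intro t ht h0
        have heq : E n t = E (n + 1) t := by linarith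
        refine ⟨_, ?_, (hE n t (Ioc_subset_Icc_self ht)).sub (hE (n + 1) t (Ioc_subset_Icc_self ht))⟩
        rw [heq]
        linarith [hdecr n t (E (n + 1) t)]) x hx
    linarith
  have hlipE : ∀ n, LipschitzOnWith ⟨C, hC⟩ (E n) (Icc x₁ b) := fun n =>
    (convex_Icc x₁ b).lipschitzOnWith_of_nnnorm_hasDerivWithin_le (hE n)
      fun x hx => hbound n x hx _
  have hanti : ∀ x ∈ Icc x₁ b, Antitone fun n => E n x := fun x hx =>
    antitone_nat_of_succ_le fun n => (hEdecr n x hx).le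
  have hbdd : ∀ x ∈ Icc x₁ b, BddBelow (range fun n => E n x) := by
    intro x hx
    refine ⟨-(C * (b - x₁)), ?_⟩
    rintro _ ⟨n, rfl⟩
    have h1 := (hlipE n).dist_le_mul x hx x₁ hx₁
    rw [Real.dist_eq, Real.dist_eq, abs_of_nonneg (sub_nonneg.2 hx.1)] at h1
    have h2 := (abs_le.1 h1).1
    have h3 : C * (x - x₁) ≤ C * (b - x₁) := mul_le_mul_of_nonneg_left (by linarith [hx.2]) hC
    have h4 : 0 < E n x₁ := by rw [hE0]; positivity
    change -(C * (x - x₁)) ≤ _ at h2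
    linarith
  have htend : ∀ x ∈ Icc x₁ b, Tendsto (fun n => E n x) atTop (𝓝 (⨅ n, E n x)) := fun x hx =>
    tendsto_atTop_ciInf (hanti x hx) (hbdd x hx)
  set e : ℝ → ℝ := fun x => ⨅ n, E n x with he
  have hec : ContinuousOn e (Icc x₁ b) := by
    have : LipschitzOnWith ⟨C, hC⟩ e (Icc x₁ b) := by
      refine LipschitzOnWith.of_dist_le_mul fun x hx y hy => ?_
      exact le_of_tendsto ((htend x hx).dist (htend y hy))
        (Eventually.of_forall fun n => (hlipE n).dist_le_mul x hx y hy)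
    exact this.continuousOn
  have he0 : e x₁ = 0 := by
    refine tendsto_nhds_unique (htend x₁ hx₁) ?_
    simp only [hE0]
    exact tendsto_one_div_add_atTop_nhds_zero_nat
  -- The limit is taken in the integral equation, by dominated convergence with the common bound
  -- `C`.
  have hint : ∀ x ∈ Icc x₁ b, e x = ODE.picard φ x₁ 0 e x := by
    intro x hx
    have hsub : uIcc x₁ x ⊆ Icc x₁ b := by
      rw [uIcc_of_le hx.1]
      exact Icc_subset_Icc_right hx.2
    have h1 : ∀ n, E n x = 1 / ((n : ℝ) + 1) + ∫ τ in x₁..x, ψ n τ (E n τ) := by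
      intro n
      have := ODE.picard_eq_of_hasDerivAt (f := ψ n) (α := E n) (t₀ := x₁) (t := x) (u := univ)
        (hψ n).continuousOn (fun t ht => (hE n t (hsub ht)).mono hsub) (fun _ _ => mem_univ _)
      rw [← this, ODE.picard_apply, hE0]
    have h2 : Tendsto (fun n => ∫ τ in x₁..x, ψ n τ (E n τ)) atTop
        (𝓝 (∫ τ in x₁..x, φ τ (e τ))) := by
      refine intervalIntegral.tendsto_integral_filter_of_dominated_convergence (fun _ => C) ?_ ?_
        intervalIntegrable_const ?_
      · refine Eventually.of_forall fun n => ?_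
        have hc : ContinuousOn (fun τ => ψ n τ (E n τ)) (uIoc x₁ x) :=
          (hψ n).comp_continuousOn (continuousOn_id.prodMk
            ((hEc n).mono (uIoc_subset_uIcc.trans hsub)))
        exact hc.aestronglyMeasurable measurableSet_uIoc
      · exact Eventually.of_forall fun n => Eventually.of_forall fun τ hτ =>
          hbound n τ (hsub (uIoc_subset_uIcc hτ)) _
      · exact Eventually.of_forall fun τ hτ => hlim τ _ _ (htend τ (hsub (uIoc_subset_uIcc hτ)))
    refine tendsto_nhds_unique (htend x hx) ?_
    simp only [h1]
    exact tendsto_one_div_add_atTop_nhds_zero_nat.add h2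
  refine ⟨e, E, he0, fun x hx => ?_, fun n x hx => ?_, fun n x hx =>
    ⟨_, hgt n x _, hE n x hx⟩, htend⟩
  · exact (ODE.hasDerivWithinAt_picard_Icc hx₁ (u := univ) hφ.continuousOn hec
      (fun _ _ => mem_univ _) 0 hx).congr hint (hint x hx)
  · exact (ciInf_le (hbdd x hx) (n + 1)).trans_lt (hEdecr n x hx)

/-! ### The energy equation with truncated speed. -/

/-- The speed `√(2e)` at energy `e`, the energy being truncated to `[0, N]`. -/
noncomputable def truncSpeed (N e : ℝ) : ℝ := √(2 * max 0 (min e N))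

theorem continuous_truncSpeed (N : ℝ) : Continuous (truncSpeed N) := by
  unfold truncSpeed
  fun_prop

theorem truncSpeed_of_mem {N e : ℝ} (h0 : 0 ≤ e) (hN : e ≤ N) : truncSpeed N e = √(2 * e) := by
  rw [truncSpeed, min_eq_left hN, max_eq_right h0]

theorem truncSpeed_of_nonpos {N e : ℝ} (h : e ≤ 0) : truncSpeed N e = 0 := by
  rw [truncSpeed, max_eq_left ((min_le_left _ _).trans h)]
  simp

theorem sqrt_add_sub_sqrt_lipschitz {δ : ℝ} (hδ : 0 < δ) {a b : ℝ} (ha : 0 ≤ a) (hb : 0 ≤ b) :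
    |√(a + δ) - √(b + δ)| ≤ |a - b| / √δ := by
  have h1 : √δ ≤ √(a + δ) := Real.sqrt_le_sqrt (by linarith)
  have h3 : 0 < √δ := Real.sqrt_pos.2 hδ
  have h4 : 0 ≤ √(b + δ) := Real.sqrt_nonneg _
  have h5 : (√(a + δ) - √(b + δ)) * (√(a + δ) + √(b + δ)) = a - b := by
    have e1 := Real.mul_self_sqrt (by linarith : 0 ≤ a + δ)
    have e2 := Real.mul_self_sqrt (by linarith : 0 ≤ b + δ)
    nlinarith
  rw [le_div_iff₀ h3, ← h5, abs_mul]
  refine mul_le_mul_of_nonneg_left ?_ (abs_nonneg _)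
  rw [abs_of_nonneg (by linarith)]
  linarith

theorem abs_max_min_sub_le (N a b : ℝ) :
    |max 0 (min a N) - max 0 (min b N)| ≤ |a - b| := by
  have h1 : LipschitzWith 1 fun e : ℝ => max 0 (min e N) :=
    (LipschitzWith.id.min_const N).const_max 0
  simpa [Real.dist_eq] using h1.dist_le_mul a b

/-- The square root fails to be Lipschitz at zero energy, exactly where half-orbits start. The
truncation bounds the right-hand side, so solutions live on the whole interval. The supersolutions
`E n` are kept in the conclusion because the first-zero argument needs a strict inequality at a
contact; comparisons for `e` follow in the limit. -/
theorem exists_maximal_solution {f g : ℝ → ℝ} (hf : Continuous f) (hg : Continuous g) {N : ℝ}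
    (hN : 0 ≤ N) {x₁ b : ℝ} (hb : x₁ ≤ b) :
    ∃ (e : ℝ → ℝ) (E : ℕ → ℝ → ℝ), e x₁ = 0 ∧
      (∀ x ∈ Icc x₁ b, HasDerivWithinAt e (-f x * truncSpeed N (e x) - g x) (Icc x₁ b) x) ∧
      (∀ n, ∀ x ∈ Icc x₁ b, e x < E n x) ∧
      (∀ n, ∀ x ∈ Icc x₁ b, ∃ D, -f x * truncSpeed N (E n x) - g x < D ∧
        HasDerivWithinAt (E n) D (Icc x₁ b) x) ∧
      ∀ x ∈ Icc x₁ b, Tendsto (fun n => E n x) atTop (𝓝 (e x)) := by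
  obtain ⟨A, hA⟩ := isCompact_Icc.exists_bound_of_continuousOn
    (hf.continuousOn (s := Icc x₁ b))
  obtain ⟨B, hB⟩ := isCompact_Icc.exists_bound_of_continuousOn
    (hg.continuousOn (s := Icc x₁ b))
  simp only [Real.norm_eq_abs] at hA hB
  have hA0 : 0 ≤ A := (abs_nonneg _).trans (hA x₁ ⟨le_rfl, hb⟩)
  set c : ℝ → ℝ := fun e => max 0 (min e N) with hc
  have hc0 : ∀ e, 0 ≤ c e := fun e => le_max_left _ _
  have hcN : ∀ e, c e ≤ N := fun e => max_le hN (min_le_right _ _)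
  have hcc : Continuous c := by fun_prop
  set δ : ℕ → ℝ := fun n => 1 / ((n : ℝ) + 1) with hδ
  have hδ0 : ∀ n, 0 < δ n := fun n => by simp only [hδ]; positivity
  have hδ1 : ∀ n, δ n ≤ 1 := fun n => by
    simp only [hδ]
    rw [div_le_one (by positivity)]
    linarith [n.cast_nonneg (α := ℝ)]
  have hδd : ∀ n, δ (n + 1) < δ n := fun n =>
    one_div_lt_one_div_of_lt (Nat.cast_add_one_pos n) (by push_cast; linarith)
  have hδt : Tendsto δ atTop (𝓝 0) := tendsto_one_div_add_atTop_nhds_zero_nat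
  -- Monotonicity in `δ` has to hold for both signs of `f`. If `f ≤ 0`, then `-f √(2c + δ)`
  -- increases with `δ`; if `f ≥ 0`, the added term gives `-f (√(2c + δ) - √δ)`, which also
  -- increases. The last `δ` makes it strict.
  set ψ : ℕ → ℝ → ℝ → ℝ := fun n x e =>
    -f x * √(2 * c e + δ n) + max (f x) 0 * √(δ n) - g x + δ n with hψ
  have hsq : ∀ n, √(δ n) ≤ 1 := fun n => Real.sqrt_le_one.2 (hδ1 n)
  refine exists_maximal_solution_of_approx (φ := fun x e => -f x * truncSpeed N e - g x) (ψ := ψ)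
    (C := A * √(2 * N + 1) + A + B + 1)
    (K := fun n => ⟨A * 2 / √(δ n), by positivity⟩) hb ?_ ?_ ?_ ?_ ?_ ?_ ?_
  · intro n
    simp only [hψ, Function.uncurry_def]
    fun_prop
  · simp only [Function.uncurry_def]
    have := continuous_truncSpeed N
    fun_prop
  · intro n x hx e
    simp only [hψ]
    have h1 : |-f x * √(2 * c e + δ n)| ≤ A * √(2 * N + 1) := by
      rw [abs_mul, abs_neg, abs_of_nonneg (Real.sqrt_nonneg _)]
      exact mul_le_mul (hA x hx) (Real.sqrt_le_sqrt (by linarith [hcN e, hδ1 n]))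
        (Real.sqrt_nonneg _) hA0
    have h2 : |max (f x) 0 * √(δ n)| ≤ A := by
      rw [abs_mul, abs_of_nonneg (Real.sqrt_nonneg _), abs_of_nonneg (le_max_right _ _)]
      calc max (f x) 0 * √(δ n) ≤ A * 1 :=
            mul_le_mul (max_le ((le_abs_self _).trans (hA x hx)) hA0) (hsq n)
              (Real.sqrt_nonneg _) hA0
        _ = A := mul_one A
    have h3 := hB x hx
    rw [abs_le] at h1 h2 h3 ⊢
    constructor <;> linarith [hδ0 n, hδ1 n, h1.1, h1.2, h2.1, h2.2, h3.1, h3.2]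
  · intro n x hx
    refine LipschitzWith.of_dist_le_mul fun u v => ?_
    simp only [hψ, Real.dist_eq]
    have h1 := sqrt_add_sub_sqrt_lipschitz (hδ0 n)
      (mul_nonneg zero_le_two (hc0 u)) (mul_nonneg zero_le_two (hc0 v))
    have h2 : |2 * c u - 2 * c v| ≤ 2 * |u - v| := by
      rw [← mul_sub, abs_mul, abs_two]
      linarith [abs_max_min_sub_le N u v]
    have h3 : |√(2 * c u + δ n) - √(2 * c v + δ n)| ≤ 2 * |u - v| / √(δ n) :=
      h1.trans (by gcongr)
    calc _ = |f x| * |√(2 * c u + δ n) - √(2 * c v + δ n)| := by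
          rw [← abs_mul, ← abs_neg]
          congr 1
          ring
      _ ≤ A * (2 * |u - v| / √(δ n)) := mul_le_mul (hA x hx) h3 (abs_nonneg _) hA0
      _ = A * 2 / √(δ n) * |u - v| := by ring
  · intro n x e
    have ha := hc0 e
    have hlt := Real.sqrt_le_sqrt (hδd n).le
    have h0 : √(2 * c e + δ (n + 1)) ≤ √(2 * c e + δ n) :=
      Real.sqrt_le_sqrt (by linarith [hδd n])
    have hs : √(2 * c e + δ n) - √(δ n) ≤ √(2 * c e + δ (n + 1)) - √(δ (n + 1)) := by
      have e1 := Real.mul_self_sqrt (by linarith [hδ0 n] : 0 ≤ 2 * c e + δ n)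
      have e2 := Real.mul_self_sqrt (by linarith [hδ0 (n + 1)] : 0 ≤ 2 * c e + δ (n + 1))
      have e3 := Real.mul_self_sqrt (hδ0 n).le
      have e4 := Real.mul_self_sqrt (hδ0 (n + 1)).le
      have p2 := Real.sqrt_pos.2 (by linarith [hδ0 (n + 1)] : 0 < 2 * c e + δ (n + 1))
      have p4 := Real.sqrt_pos.2 (hδ0 (n + 1))
      have p3 : √(δ n) ≤ √(2 * c e + δ n) := Real.sqrt_le_sqrt (by linarith)
      have p5 : √(δ (n + 1)) ≤ √(2 * c e + δ (n + 1)) := Real.sqrt_le_sqrt (by linarith)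
      by_contra hcon
      push Not at hcon
      nlinarith
    simp only [hψ]
    rcases le_total 0 (f x) with h | h
    · rw [max_eq_left h]
      nlinarith [hδd n]
    · rw [max_eq_right h]
      nlinarith [hδd n]
  · intro n x e
    have ha := hc0 e
    have h1 : √(2 * c e) ≤ √(2 * c e + δ n) := Real.sqrt_le_sqrt (by linarith [hδ0 n])
    have h2 : √(2 * c e + δ n) ≤ √(2 * c e) + √(δ n) := by
      have e1 := Real.sqrt_nonneg (2 * c e)
      have e2 := Real.sqrt_nonneg (δ n)
      rw [Real.sqrt_le_left (by positivity)]
      nlinarith [Real.sq_sqrt (by linarith : 0 ≤ 2 * c e), Real.sq_sqrt (hδ0 n).le]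
    simp only [hψ, truncSpeed]
    rcases le_total 0 (f x) with h | h
    · rw [max_eq_left h]
      nlinarith [hδ0 n]
    · rw [max_eq_right h]
      nlinarith [hδ0 n]
  · intro x u e hu
    simp only [hψ, truncSpeed]
    have h1 : Tendsto (fun n => 2 * c (u n) + δ n) atTop (𝓝 (2 * c e + 0)) :=
      (((hcc.tendsto e).comp hu).const_mul 2).add hδt
    have h2 := (Real.continuous_sqrt.tendsto _).comp h1
    have h3 := (Real.continuous_sqrt.tendsto _).comp hδt
    have h4 := (((h2.const_mul (-f x)).add (h3.const_mul (max (f x) 0))).sub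
      (tendsto_const_nhds (x := g x))).add hδt
    simpa [Function.comp_def] using h4

/-! ### The barrier curve and its central symmetry. -/

/-- Data of a closed transversal curve `(y - s)² + 2 V = M²`: the shift `s` equals `ε` left of `n₁`
and `-ε` right of `n₂`, and `V` is the increment of the potential `G` beyond `[n₁, n₂]`. -/
structure BarrierData (f g G s : ℝ → ℝ) (n₁ n₂ b₁ b₂ κ M ε : ℝ) : Prop where
  continuous_f : Continuous f
  continuous_g : Continuous g
  hasDerivAt_G : ∀ x, HasDerivAt G (g x) x
  hasDerivAt_s : ∀ x, HasDerivAt s (κ - f x) x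
  s_left : s n₁ = ε
  s_right : s n₂ = -ε
  lt : n₁ < n₂
  κ_pos : 0 < κ
  ε_pos : 0 < ε
  ε_lt : ε < M
  g_bound : ∃ c, 0 < c ∧ (∀ x ≤ n₁, g x ≤ -c) ∧ ∀ x, n₂ ≤ x → c ≤ g x
  f_left : ∀ x ≤ n₁, 0 < f x
  f_right : ∀ x, n₂ ≤ x → 0 < f x
  ratio_left : ∀ x ≤ n₁, ε * f x < -g x
  ratio_right : ∀ x, n₂ ≤ x → ε * f x < g x
  mid : ∀ x ∈ Icc n₁ n₂, |g x| < κ * (M - |s x|)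
  b₁_lt : b₁ < n₁
  lt_b₂ : n₂ < b₂
  level_left : M ^ 2 / 2 < G b₁ - G n₁
  level_right : M ^ 2 / 2 < G b₂ - G n₂

namespace BarrierData

variable {f g G s : ℝ → ℝ} {n₁ n₂ b₁ b₂ κ M ε : ℝ}

theorem g_left (D : BarrierData f g G s n₁ n₂ b₁ b₂ κ M ε) {x : ℝ} (hx : x ≤ n₁) : g x < 0 := by
  obtain ⟨c, hc, h, -⟩ := D.g_bound
  linarith [h x hx]

theorem g_right (D : BarrierData f g G s n₁ n₂ b₁ b₂ κ M ε) {x : ℝ} (hx : n₂ ≤ x) : 0 < g x := by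
  obtain ⟨c, hc, -, h⟩ := D.g_bound
  linarith [h x hx]

theorem M_pos (D : BarrierData f g G s n₁ n₂ b₁ b₂ κ M ε) : 0 < M := D.ε_pos.trans D.ε_lt

theorem abs_s_lt (D : BarrierData f g G s n₁ n₂ b₁ b₂ κ M ε) {x : ℝ} (hx : x ∈ Icc n₁ n₂) :
    |s x| < M := by
  have h := (abs_nonneg _).trans_lt (D.mid x hx)
  have := (mul_pos_iff_of_pos_left D.κ_pos).1 h
  linarith

theorem G_strictAntiOn (D : BarrierData f g G s n₁ n₂ b₁ b₂ κ M ε) :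
    StrictAntiOn G (Iic n₁) := by
  refine strictAntiOn_of_deriv_neg (convex_Iic _)
    (fun x _ => (D.hasDerivAt_G x).continuousAt.continuousWithinAt) fun x hx => ?_
  rw [(D.hasDerivAt_G x).deriv]
  exact D.g_left (mem_Iic.1 (interior_subset hx))

theorem G_strictMonoOn (D : BarrierData f g G s n₁ n₂ b₁ b₂ κ M ε) :
    StrictMonoOn G (Ici n₂) := by
  refine strictMonoOn_of_deriv_pos (convex_Ici _)
    (fun x _ => (D.hasDerivAt_G x).continuousAt.continuousWithinAt) fun x hx => ?_
  rw [(D.hasDerivAt_G x).deriv]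
  exact D.g_right (mem_Ici.1 (interior_subset hx))

/-- The data are invariant under the central symmetry `(x, y) ↦ (-x, -y)`. -/
theorem reflect (D : BarrierData f g G s n₁ n₂ b₁ b₂ κ M ε) :
    BarrierData (fun x => f (-x)) (fun x => -g (-x)) (fun x => G (-x)) (fun x => -s (-x))
      (-n₂) (-n₁) (-b₂) (-b₁) κ M ε where
  continuous_f := D.continuous_f.comp continuous_neg
  continuous_g := (D.continuous_g.comp continuous_neg).neg
  hasDerivAt_G x := ((D.hasDerivAt_G (-x)).scomp x (hasDerivAt_neg x)).congr_deriv (by simp)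
  hasDerivAt_s x := ((D.hasDerivAt_s (-x)).scomp x (hasDerivAt_neg x)).neg.congr_deriv (by simp)
  s_left := by simp [D.s_right]
  s_right := by simp [D.s_left]
  lt := neg_lt_neg D.lt
  κ_pos := D.κ_pos
  ε_pos := D.ε_pos
  ε_lt := D.ε_lt
  g_bound := by
    obtain ⟨c, hc, h1, h2⟩ := D.g_bound
    exact ⟨c, hc, fun x hx => neg_le_neg (h2 _ (by linarith)),
      fun x hx => by linarith [h1 (-x) (by linarith)]⟩
  f_left x hx := D.f_right _ (by linarith)
  f_right x hx := D.f_left _ (by linarith)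
  ratio_left x hx := by linarith [D.ratio_right (-x) (by linarith)]
  ratio_right x hx := D.ratio_left _ (by linarith)
  mid x hx := by
    simpa using D.mid (-x) ⟨by linarith [hx.2], by linarith [hx.1]⟩
  b₁_lt := neg_lt_neg D.lt_b₂
  lt_b₂ := neg_lt_neg D.b₁_lt
  level_left := by simpa using D.level_right
  level_right := by simpa using D.level_left

end BarrierData

/-! ### The barrier as a bound on energies. -/

/-- `hpos` says that `Y² / 2` is a strict supersolution of the energy equation, so at a contact with
`e` the difference has positive derivative. -/
theorem energy_lt_of_barrier {f g e Y Y' : ℝ → ℝ} {α β N : ℝ}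
    (he : ∀ x ∈ Icc α β, HasDerivWithinAt e (-f x * truncSpeed N (e x) - g x) (Icc α β) x)
    (hY : ∀ x ∈ Icc α β, HasDerivWithinAt Y (Y' x) (Icc α β) x)
    (h0 : ∀ x ∈ Icc α β, 0 ≤ Y x) (hN : ∀ x ∈ Icc α β, Y x ^ 2 / 2 ≤ N)
    (hpos : ∀ x ∈ Icc α β, 0 < Y x * Y' x + f x * Y x + g x) (hα : e α < Y α ^ 2 / 2) :
    ∀ x ∈ Icc α β, e x < Y x ^ 2 / 2 := by
  have hd : ∀ x ∈ Icc α β, HasDerivWithinAt (fun x => Y x ^ 2 / 2 - e x)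
      (Y x * Y' x - (-f x * truncSpeed N (e x) - g x)) (Icc α β) x := by
    intro x hx
    refine ((((hY x hx).pow 2).div_const 2).sub (he x hx)).congr_deriv ?_
    push_cast
    ring
  intro x hx
  have := pos_on_Icc_of_deriv_pos (d := fun x => Y x ^ 2 / 2 - e x)
    (fun x hx => (hd x hx).continuousWithinAt) (by linarith) (fun t ht hz => ?_) x hx
  · linarith
  have ht' := Ioc_subset_Icc_self ht
  refine ⟨_, ?_, hd t ht'⟩
  have hz' : e t = Y t ^ 2 / 2 := by linarith
  have hsq : 2 * (Y t ^ 2 / 2) = Y t ^ 2 := by ring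
  rw [hz', truncSpeed_of_mem (by positivity) (hN t ht'), hsq, Real.sqrt_sq (h0 t ht')]
  linarith [hpos t ht']

/-- The upper branch of the curve is followed through its three pieces: `ε + √(M² - 2V)`, then `s +
M`, then `-ε + √(M² - 2V)`. All heights are at most `2M`, whence the cutoff `2M²` for the energy.
Over `μ₁` the branch has height `2ε > 0`. -/
theorem BarrierData.energy_lt {f g G s : ℝ → ℝ} {n₁ n₂ b₁ b₂ κ M ε μ₁ μ₂ : ℝ}
    (D : BarrierData f g G s n₁ n₂ b₁ b₂ κ M ε) (hμ₁ : μ₁ < n₁) (hμ₂ : n₂ < μ₂)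
    (hG₁ : G μ₁ - G n₁ = (M ^ 2 - ε ^ 2) / 2) (hG₂ : G μ₂ - G n₂ = (M ^ 2 - ε ^ 2) / 2)
    {e : ℝ → ℝ} (he0 : e μ₁ = 0)
    (he : ∀ x ∈ Icc μ₁ μ₂,
      HasDerivWithinAt e (-f x * truncSpeed (2 * M ^ 2) (e x) - g x) (Icc μ₁ μ₂) x) :
    (∀ x ∈ Icc μ₁ μ₂, e x < 2 * M ^ 2) ∧ e μ₂ < 0 := by
  have hε := D.ε_pos
  have hεM := D.ε_lt
  have hM := D.M_pos
  have hn := D.lt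
  have hl : ∀ x ∈ Icc μ₁ n₁, ε ^ 2 ≤ M ^ 2 - 2 * (G x - G n₁) ∧
      M ^ 2 - 2 * (G x - G n₁) ≤ M ^ 2 := by
    intro x hx
    have h1 := D.G_strictAntiOn.antitoneOn (mem_Iic.2 hμ₁.le) (mem_Iic.2 hx.2) hx.1
    have h2 := D.G_strictAntiOn.antitoneOn (mem_Iic.2 hx.2) (mem_Iic.2 le_rfl) hx.2
    constructor <;> linarith
  have hr : ∀ x ∈ Icc n₂ μ₂, ε ^ 2 ≤ M ^ 2 - 2 * (G x - G n₂) ∧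
      M ^ 2 - 2 * (G x - G n₂) ≤ M ^ 2 := by
    intro x hx
    have h1 := D.G_strictMonoOn.monotoneOn (mem_Ici.2 hx.1) (mem_Ici.2 hμ₂.le) hx.2
    have h2 := D.G_strictMonoOn.monotoneOn (mem_Ici.2 le_rfl) (mem_Ici.2 hx.1) hx.1
    constructor <;> linarith
  have hsq : ∀ q : ℝ, ε ^ 2 ≤ q → q ≤ M ^ 2 → ε ≤ √q ∧ √q ≤ M := fun q h1 h2 =>
    ⟨Real.le_sqrt_of_sq_le h1, Real.sqrt_le_iff.2 ⟨hM.le, h2⟩⟩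
  have hN : ∀ y : ℝ, 0 ≤ y → y ≤ 2 * M → y ^ 2 / 2 ≤ 2 * M ^ 2 := fun y h1 h2 => by nlinarith
  have hder : ∀ c x : ℝ, ε ^ 2 ≤ M ^ 2 - 2 * (G x - c) →
      HasDerivAt (fun x => √(M ^ 2 - 2 * (G x - c))) (-g x / √(M ^ 2 - 2 * (G x - c))) x := by
    intro c x hx
    have h1 : HasDerivAt (fun x => M ^ 2 - 2 * (G x - c)) (-(2 * g x)) x := by
      simpa using (((D.hasDerivAt_G x).sub_const c).const_mul 2).const_sub (M ^ 2)
    have h2 : 0 < M ^ 2 - 2 * (G x - c) := lt_of_lt_of_le (by positivity) hx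
    convert h1.sqrt h2.ne' using 1
    have := Real.sqrt_pos.2 h2
    field_simp
  have hleft : ∀ x ∈ Icc μ₁ n₁, e x < (ε + √(M ^ 2 - 2 * (G x - G n₁))) ^ 2 / 2 := by
    have hsub : Icc μ₁ n₁ ⊆ Icc μ₁ μ₂ := Icc_subset_Icc_right (by linarith)
    refine energy_lt_of_barrier (N := 2 * M ^ 2) (fun x hx => (he x (hsub hx)).mono hsub)
      (fun x hx => ((hder _ x (hl x hx).1).const_add ε).hasDerivWithinAt) ?_ ?_ ?_ ?_
    · intro x hx
      positivity
    · intro x hx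
      obtain ⟨h1, h2⟩ := hsq _ (hl x hx).1 (hl x hx).2
      exact hN _ (by positivity) (by linarith)
    · intro x hx
      obtain ⟨h1, h2⟩ := hsq _ (hl x hx).1 (hl x hx).2
      have hg := D.g_left hx.2
      have hf := D.f_left x hx.2
      set R := √(M ^ 2 - 2 * (G x - G n₁)) with hR
      have hR0 : 0 < R := hε.trans_le h1
      have e1 : (ε + R) * (-g x / R) + f x * (ε + R) + g x = ε * (-g x) / R + f x * (ε + R) := by
        field_simp
        ring
      rw [e1]
      have : 0 < -g x := by linarith
      positivity
    · rw [he0]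
      positivity
  have hmid : ∀ x ∈ Icc n₁ n₂, e x < (s x + M) ^ 2 / 2 := by
    have hsub : Icc n₁ n₂ ⊆ Icc μ₁ μ₂ := Icc_subset_Icc hμ₁.le hμ₂.le
    refine energy_lt_of_barrier (N := 2 * M ^ 2) (fun x hx => (he x (hsub hx)).mono hsub)
      (fun x hx => ((D.hasDerivAt_s x).add_const M).hasDerivWithinAt) ?_ ?_ ?_ ?_
    · intro x hx
      linarith [(abs_lt.1 (D.abs_s_lt hx)).1]
    · intro x hx
      have := abs_lt.1 (D.abs_s_lt hx)
      exact hN _ (by linarith [this.1]) (by linarith [this.2])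
    · intro x hx
      have h1 := D.mid x hx
      have h2 : κ * (M - |s x|) ≤ κ * (s x + M) :=
        mul_le_mul_of_nonneg_left (by linarith [neg_abs_le (s x)]) D.κ_pos.le
      nlinarith [neg_abs_le (g x)]
    · have := hleft n₁ ⟨hμ₁.le, le_rfl⟩
      rw [sub_self, mul_zero, sub_zero, Real.sqrt_sq hM.le] at this
      rwa [D.s_left]
  have hright : ∀ x ∈ Icc n₂ μ₂, e x < (-ε + √(M ^ 2 - 2 * (G x - G n₂))) ^ 2 / 2 := by
    have hsub : Icc n₂ μ₂ ⊆ Icc μ₁ μ₂ := Icc_subset_Icc_left (by linarith)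
    refine energy_lt_of_barrier (N := 2 * M ^ 2) (fun x hx => (he x (hsub hx)).mono hsub)
      (fun x hx => ((hder _ x (hr x hx).1).const_add (-ε)).hasDerivWithinAt) ?_ ?_ ?_ ?_
    · intro x hx
      linarith [(hsq _ (hr x hx).1 (hr x hx).2).1]
    · intro x hx
      obtain ⟨h1, h2⟩ := hsq _ (hr x hx).1 (hr x hx).2
      exact hN _ (by linarith) (by linarith)
    · intro x hx
      obtain ⟨h1, h2⟩ := hsq _ (hr x hx).1 (hr x hx).2
      have hg := D.g_right hx.1
      have hf := D.f_right x hx.1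
      set R := √(M ^ 2 - 2 * (G x - G n₂)) with hR
      have hR0 : 0 < R := hε.trans_le h1
      have e1 : (-ε + R) * (-g x / R) + f x * (-ε + R) + g x =
          ε * g x / R + f x * (R - ε) := by
        field_simp
        ring
      rw [e1]
      have h3 : 0 ≤ R - ε := by linarith
      positivity
    · have := hmid n₂ ⟨hn.le, le_rfl⟩
      rw [sub_self, mul_zero, sub_zero, Real.sqrt_sq hM.le]
      rwa [D.s_right] at this
  refine ⟨fun x hx => ?_, ?_⟩
  · rcases le_total x n₁ with h | h
    · obtain ⟨h1, h2⟩ := hsq _ (hl x ⟨hx.1, h⟩).1 (hl x ⟨hx.1, h⟩).2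
      exact (hleft x ⟨hx.1, h⟩).trans_le (hN _ (by positivity) (by linarith))
    rcases le_total x n₂ with h' | h'
    · have := abs_lt.1 (D.abs_s_lt ⟨h, h'⟩)
      exact (hmid x ⟨h, h'⟩).trans_le (hN _ (by linarith [this.1]) (by linarith [this.2]))
    · obtain ⟨h1, h2⟩ := hsq _ (hr x ⟨h', hx.2⟩).1 (hr x ⟨h', hx.2⟩).2
      exact (hright x ⟨h', hx.2⟩).trans_le (hN _ (by linarith) (by linarith))
  -- Over `μ₂` the branch has height `-ε + ε = 0`, so the energy is already negative there.
  · have := hright μ₂ ⟨hμ₂.le, le_rfl⟩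
    rw [hG₂] at this
    have e1 : M ^ 2 - 2 * ((M ^ 2 - ε ^ 2) / 2) = ε ^ 2 := by ring
    rw [e1, Real.sqrt_sq hε.le] at this
    simpa using this

/-! ### Half-orbits and the half-return map. -/

/-- An arc of trajectory in the upper half-plane from `(x₁, 0)` to `(x₂, 0)`, described by its
energy `e = y² / 2` as a function of `x`. -/
def HalfOrbit (f g : ℝ → ℝ) (x₁ x₂ : ℝ) : Prop :=
  x₁ < x₂ ∧ ∃ e : ℝ → ℝ, e x₁ = 0 ∧ e x₂ = 0 ∧ (∀ x ∈ Ioo x₁ x₂, 0 < e x) ∧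
    ∀ x ∈ Icc x₁ x₂, HasDerivWithinAt e (-f x * √(2 * e x) - g x) (Icc x₁ x₂) x

/-- A trajectory on `[t₀, t₁]` that goes from `(m₁, 0)` to `(m₂, 0)` through `{y > 0}`. -/
structure UpperArc (f g X Y : ℝ → ℝ) (t₀ t₁ m₁ m₂ : ℝ) : Prop where
  lt : t₀ < t₁
  deriv_X : ∀ t ∈ Icc t₀ t₁, HasDerivWithinAt X (Y t) (Icc t₀ t₁) t
  deriv_Y : ∀ t ∈ Icc t₀ t₁, HasDerivWithinAt Y (-f (X t) * Y t - g (X t)) (Icc t₀ t₁) t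
  X_left : X t₀ = m₁
  X_right : X t₁ = m₂
  Y_left : Y t₀ = 0
  Y_right : Y t₁ = 0
  Y_pos : ∀ t ∈ Ioo t₀ t₁, 0 < Y t

theorem UpperArc.Y_nonneg {f g X Y : ℝ → ℝ} {t₀ t₁ m₁ m₂ : ℝ} (A : UpperArc f g X Y t₀ t₁ m₁ m₂)
    {t : ℝ} (ht : t ∈ Icc t₀ t₁) : 0 ≤ Y t := by
  rcases ht.1.lt_or_eq with h1 | h1
  · rcases ht.2.lt_or_eq with h2 | h2
    · exact (A.Y_pos t ⟨h1, h2⟩).le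
    · rw [h2, A.Y_right]
  · rw [← h1, A.Y_left]

theorem UpperArc.X_monotoneOn {f g X Y : ℝ → ℝ} {t₀ t₁ m₁ m₂ : ℝ}
    (A : UpperArc f g X Y t₀ t₁ m₁ m₂) : MonotoneOn X (Icc t₀ t₁) := by
  refine monotoneOn_of_hasDerivWithinAt_nonneg (f' := Y) (convex_Icc _ _)
    (fun t ht => (A.deriv_X t ht).continuousWithinAt)
    (fun t ht => (A.deriv_X t (interior_subset ht)).mono interior_subset)
    (fun t ht => A.Y_nonneg (interior_subset ht))

theorem UpperArc.X_mem {f g X Y : ℝ → ℝ} {t₀ t₁ m₁ m₂ : ℝ} (A : UpperArc f g X Y t₀ t₁ m₁ m₂)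
    {t : ℝ} (ht : t ∈ Icc t₀ t₁) : X t ∈ Icc m₁ m₂ := by
  rw [← A.X_left, ← A.X_right]
  exact ⟨A.X_monotoneOn ⟨le_rfl, A.lt.le⟩ ht ht.1, A.X_monotoneOn ht ⟨A.lt.le, le_rfl⟩ ht.2⟩

/-- A strict supersolution that starts above an arc of trajectory stays above it. -/
theorem UpperArc.energy_lt {f g X Y E : ℝ → ℝ} {t₀ t₁ m₁ m₂ x₁ b N : ℝ}
    (A : UpperArc f g X Y t₀ t₁ m₁ m₂) (hx₁ : x₁ ≤ m₁) (hb : m₂ ≤ b)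
    (hN : ∀ t ∈ Icc t₀ t₁, Y t ^ 2 / 2 ≤ N)
    (hE : ∀ x ∈ Icc x₁ b, ∃ D, -f x * truncSpeed N (E x) - g x < D ∧
        HasDerivWithinAt E D (Icc x₁ b) x)
    (h0 : 0 < E m₁) : ∀ t ∈ Ico t₀ t₁, Y t ^ 2 / 2 < E (X t) := by
  intro t ht
  have hsub : Icc t₀ t ⊆ Icc t₀ t₁ := Icc_subset_Icc_right ht.2.le
  have hmaps : MapsTo X (Icc t₀ t) (Icc x₁ b) := fun u hu =>
    ⟨hx₁.trans (A.X_mem (hsub hu)).1, (A.X_mem (hsub hu)).2.trans hb⟩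
  have hd : ∀ u ∈ Icc t₀ t, ∃ D, -f (X u) * truncSpeed N (E (X u)) - g (X u) < D ∧
      HasDerivWithinAt (fun u => E (X u) - Y u ^ 2 / 2)
        (Y u * D - Y u * (-f (X u) * Y u - g (X u))) (Icc t₀ t) u := by
    intro u hu
    obtain ⟨D, hD, hder⟩ := hE (X u) (hmaps hu)
    refine ⟨D, hD, ?_⟩
    have h1 := HasDerivWithinAt.scomp u hder ((A.deriv_X u (hsub hu)).mono hsub) hmaps
    have h2 := (((A.deriv_Y u (hsub hu)).mono hsub).pow 2).div_const 2
    refine (h1.sub h2).congr_deriv ?_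
    rw [smul_eq_mul]
    push_cast
    ring
  have := pos_on_Icc_of_deriv_pos (d := fun u => E (X u) - Y u ^ 2 / 2) (α := t₀) (β := t)
    (fun u hu => (hd u hu).choose_spec.2.continuousWithinAt)
    (by simp only [A.X_left, A.Y_left]; simpa using h0) (fun u hu hz => ?_) t ⟨ht.1, le_rfl⟩
  · linarith
  obtain ⟨D, hD, hder⟩ := hd u (Ioc_subset_Icc_self hu)
  refine ⟨_, ?_, hder⟩
  have hYu := A.Y_pos u ⟨hu.1, hu.2.trans_lt ht.2⟩
  have hz' : E (X u) = Y u ^ 2 / 2 := by linarith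
  have hsq : 2 * (Y u ^ 2 / 2) = Y u ^ 2 := by ring
  rw [hz', truncSpeed_of_mem (by positivity) (hN u (hsub (Ioc_subset_Icc_self hu))), hsq,
    Real.sqrt_sq hYu.le] at hD
  rw [← mul_sub]
  exact mul_pos hYu (by linarith)

/-- The half-return map in the upper half-plane between an arc of trajectory and the barrier. -/
theorem BarrierData.exists_half_return {f g G s X Y : ℝ → ℝ}
    {n₁ n₂ b₁ b₂ κ M ε μ₁ μ₂ xs t₀ t₁ m₁ m₂ : ℝ}
    (D : BarrierData f g G s n₁ n₂ b₁ b₂ κ M ε) (hμ₁ : μ₁ < n₁) (hμ₂ : n₂ < μ₂)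
    (hG₁ : G μ₁ - G n₁ = (M ^ 2 - ε ^ 2) / 2) (hG₂ : G μ₂ - G n₂ = (M ^ 2 - ε ^ 2) / 2)
    (hneg : ∀ x < xs, g x < 0)
    (A : UpperArc f g X Y t₀ t₁ m₁ m₂) (hY : ∀ t ∈ Icc t₀ t₁, Y t ≤ 2 * M)
    (hm₁ : n₁ < m₁) (hm₁s : m₁ < xs) (hsm₂ : xs < m₂) (hm₂ : m₂ < n₂) :
    ∃ T : ℝ → ℝ, AntitoneOn T (Icc μ₁ m₁) ∧
      ∀ x ∈ Icc μ₁ m₁, T x ∈ Icc m₂ μ₂ ∧ HalfOrbit f g x (T x) := by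
  have hM := D.M_pos
  -- For each starting abscissa, the maximal solution of the energy equation truncated at `2M²`.
  choose! e E he0 hder hlt hE hlim using fun (x₁ : ℝ) (hx₁ : x₁ ≤ μ₂) =>
    exists_maximal_solution (N := 2 * M ^ 2) D.continuous_f D.continuous_g (by positivity) hx₁
  have hle : ∀ x ∈ Icc μ₁ m₁, x ≤ μ₂ := fun x hx => by linarith [hx.2]
  have hcont : ∀ x ∈ Icc μ₁ m₁, ContinuousOn (e x) (Icc x μ₂) := fun x hx y hy =>
    (hder x (hle x hx) y hy).continuousWithinAt
  have hpos1 : ∀ x ∈ Icc μ₁ m₁, ∀ y ∈ Ioo x xs, 0 < e x y := by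
    intro x hx y hy
    have hsub : Icc x y ⊆ Icc x μ₂ := Icc_subset_Icc_right (by linarith [hy.2])
    refine pos_on_Ioc_of_deriv_pos ((hcont x hx).mono hsub) (he0 x (hle x hx)).ge
      (fun t ht hz => ⟨_, ?_, (hder x (hle x hx) t (hsub ht)).mono hsub⟩) y ⟨hy.1, le_rfl⟩
    rw [hz, truncSpeed_of_nonpos le_rfl]
    linarith [hneg t (by linarith [ht.2, hy.2])]
  -- Monotone dependence on the starting point: over `x'` the solution started at `x < x'` is
  -- already positive, and its supersolutions stay above the later one.
  have hcomp : ∀ x ∈ Icc μ₁ m₁, ∀ x' ∈ Icc μ₁ m₁, x ≤ x' → ∀ y ∈ Icc x' μ₂, e x' y ≤ e x y := by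
    intro x hx x' hx' hxx y hy
    rcases hxx.eq_or_lt with rfl | hxx
    · exact le_rfl
    have hsub : Icc x' μ₂ ⊆ Icc x μ₂ := Icc_subset_Icc_left hxx.le
    refine ge_of_tendsto (hlim x (hle x hx) y (hsub hy)) (Eventually.of_forall fun n => ?_)
    have := pos_on_Icc_of_deriv_pos (d := fun y => E x n y - e x' y) (α := x') (β := μ₂)
      (fun u hu => (((hE x (hle x hx) n u (hsub hu)).choose_spec.2.mono hsub).sub
        (hder x' (hle x' hx') u hu)).continuousWithinAt) ?_ ?_ y hy
    · linarith
    · have h1 := hlt x (hle x hx) n x' ⟨hxx.le, hle x' hx'⟩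
      have h2 := hpos1 x hx x' ⟨hxx, by linarith [hx'.2]⟩
      rw [he0 x' (hle x' hx')]
      linarith
    · intro t ht hz
      have ht' := Ioc_subset_Icc_self ht
      obtain ⟨D', hD', hder'⟩ := hE x (hle x hx) n t (hsub ht')
      refine ⟨_, ?_, (hder'.mono hsub).sub (hder x' (hle x' hx') t ht')⟩
      rw [show E x n t = e x' t by linarith] at hD'
      linarith
  -- The supersolutions stay above the given arc, hence so does their limit: no return to the axis
  -- occurs before `m₂`.
  have hpos2 : ∀ x ∈ Icc μ₁ m₁, ∀ y ∈ Ioo m₁ m₂, 0 < e x y := by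
    intro x hx y hy
    have hyI : y ∈ Icc (X t₀) (X t₁) := by
      rw [A.X_left, A.X_right]
      exact Ioo_subset_Icc_self hy
    obtain ⟨t, ht, hty⟩ := intermediate_value_Icc A.lt.le
      (fun t ht => (A.deriv_X t ht).continuousWithinAt) hyI
    have ht0 : t₀ < t := lt_of_le_of_ne ht.1 fun h => by
      rw [← h, A.X_left] at hty
      exact hy.1.ne hty
    have ht1 : t < t₁ := lt_of_le_of_ne ht.2 fun h => by
      rw [h, A.X_right] at hty
      exact hy.2.ne' hty
    have hYt := A.Y_pos t ⟨ht0, ht1⟩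
    have hyμ : y ∈ Icc x μ₂ := ⟨by linarith [hx.2, hy.1], by linarith [hy.2]⟩
    refine lt_of_lt_of_le (by positivity : 0 < Y t ^ 2 / 2)
      (ge_of_tendsto (hlim x (hle x hx) y hyμ) (Eventually.of_forall fun n => ?_))
    rw [← hty]
    refine (A.energy_lt hx.2 (by linarith) (fun u hu => ?_) (hE x (hle x hx) n) ?_ t
      ⟨ht.1, ht1⟩).le
    · nlinarith [A.Y_nonneg hu, hY u hu]
    · have h1 := hlt x (hle x hx) n m₁ ⟨hx.2, by linarith⟩
      rcases hx.2.eq_or_lt with h | h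
      · have h2 := he0 x (hle x hx)
        rw [← h] at h1 ⊢
        linarith
      · linarith [hpos1 x hx m₁ ⟨h, hm₁s⟩]
  have hpos : ∀ x ∈ Icc μ₁ m₁, ∀ y ∈ Ioo x m₂, 0 < e x y := by
    intro x hx y hy
    rcases lt_or_ge y xs with h | h
    · exact hpos1 x hx y ⟨hy.1, h⟩
    · exact hpos2 x hx y ⟨by linarith, hy.2⟩
  have hμm : μ₁ ∈ Icc μ₁ m₁ := ⟨le_rfl, by linarith⟩
  obtain ⟨hbar1, hbar2⟩ := D.energy_lt hμ₁ hμ₂ hG₁ hG₂ (he0 μ₁ (hle _ hμm)) (hder μ₁ (hle _ hμm))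
  have hbar : ∀ x ∈ Icc μ₁ m₁, ∀ y ∈ Icc x μ₂, e x y < 2 * M ^ 2 := fun x hx y hy =>
    (hcomp μ₁ hμm x hx hx.1 y hy).trans_lt (hbar1 y ⟨hx.1.trans hy.1, hy.2⟩)
  -- The return point is the first abscissa in `[m₂, μ₂]` with nonpositive energy. It exists because
  -- the energy at `μ₂` is negative, and it decreases in `x` because the energies do.
  set S : ℝ → Set ℝ := fun x => Icc m₂ μ₂ ∩ e x ⁻¹' Iic 0 with hS
  have hSb : ∀ x, BddBelow (S x) := fun x => ⟨m₂, fun y hy => hy.1.1⟩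
  have hsubm : ∀ x ∈ Icc μ₁ m₁, Icc m₂ μ₂ ⊆ Icc x μ₂ := fun x hx =>
    Icc_subset_Icc_left (by linarith [hx.2])
  have hSmem : ∀ x ∈ Icc μ₁ m₁, sInf (S x) ∈ S x := by
    intro x hx
    refine (((hcont x hx).mono (hsubm x hx)).preimage_isClosed_of_isClosed isClosed_Icc
      isClosed_Iic).csInf_mem ⟨μ₂, ⟨by linarith, le_rfl⟩, ?_⟩ (hSb x)
    exact (hcomp μ₁ hμm x hx hx.1 μ₂ ⟨hle x hx, le_rfl⟩).trans hbar2.le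
  refine ⟨fun x => sInf (S x), fun x hx x' hx' hxx => ?_, fun x hx => ⟨(hSmem x hx).1, ?_⟩⟩
  · refine csInf_le (hSb x') ⟨(hSmem x hx).1, ?_⟩
    exact (hcomp x hx x' hx' hxx _ (hsubm x' hx' (hSmem x hx).1)).trans (hSmem x hx).2
  set z := sInf (S x) with hz
  have hzS : z ∈ S x := hSmem x hx
  have hxz : x < z := by linarith [hx.2, hzS.1.1]
  have hzpos : ∀ y ∈ Ioo x z, 0 < e x y := by
    intro y hy
    rcases lt_or_ge y m₂ with h | h
    · exact hpos x hx y ⟨hy.1, h⟩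
    · by_contra hc
      exact absurd (csInf_le (hSb x) ⟨⟨h, hy.2.le.trans hzS.1.2⟩, not_lt.1 hc⟩) (not_le.2 hy.2)
  have hsub : Icc x z ⊆ Icc x μ₂ := Icc_subset_Icc_right hzS.1.2
  have hez : e x z = 0 := by
    refine le_antisymm hzS.2 ?_
    have ht1 : Tendsto (e x) (𝓝[<] z) (𝓝 (e x z)) :=
      (hcont x hx z (hsubm x hx hzS.1)).mono_left (nhdsWithin_le_of_mem
        (mem_of_superset (Ico_mem_nhdsLT hxz) fun u hu => hsub ⟨hu.1, hu.2.le⟩))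
    refine ge_of_tendsto ht1 ?_
    filter_upwards [Ioo_mem_nhdsLT hxz] with u hu using (hzpos u hu).le
  refine ⟨hxz, e x, he0 x (hle x hx), hez, hzpos, fun y hy => ?_⟩
  have hy0 : 0 ≤ e x y := by
    rcases hy.1.eq_or_lt with h1 | h1
    · rw [← h1, he0 x (hle x hx)]
    rcases hy.2.eq_or_lt with h2 | h2
    · rw [h2, hez]
    · exact (hzpos y ⟨h1, h2⟩).le
  have := (hder x (hle x hx) y (hsub hy)).mono hsub
  rwa [truncSpeed_of_mem hy0 (hbar x hx y (hsub hy)).le] at this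

/-! ### From energy back to time. -/

theorem hasDerivWithinAt_Icc_of_Ioo {E : Type*} [NormedAddCommGroup E] [NormedSpace ℝ E]
    {γ F : ℝ → E} {a b : ℝ} (hab : a < b) (hγ : ContinuousOn γ (Icc a b))
    (hF : ContinuousOn F (Icc a b)) (h : ∀ t ∈ Ioo a b, HasDerivAt γ (F t) t) :
    ∀ t ∈ Icc a b, HasDerivWithinAt γ (F t) (Icc a b) t := by
  have hdiff : DifferentiableOn ℝ γ (Ioo a b) := fun t ht =>
    (h t ht).differentiableAt.differentiableWithinAt
  intro t ht
  rcases ht.1.eq_or_lt with rfl | h1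
  · refine (hasDerivWithinAt_Ici_of_tendsto_deriv hdiff
      ((hγ a ht).mono Ioo_subset_Icc_self) (Ioo_mem_nhdsGT hab) ?_).mono Icc_subset_Ici_self
    have h2 : Tendsto F (𝓝[>] a) (𝓝 (F a)) :=
      (hF a ht).mono_left (nhdsWithin_le_of_mem (Icc_mem_nhdsGT hab))
    refine h2.congr' ?_
    filter_upwards [Ioo_mem_nhdsGT hab] with u hu using (h u hu).deriv.symm
  rcases ht.2.eq_or_lt with rfl | h2
  · refine (hasDerivWithinAt_Iic_of_tendsto_deriv hdiff
      ((hγ t ht).mono Ioo_subset_Icc_self) (Ioo_mem_nhdsLT hab) ?_).mono Icc_subset_Iic_self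
    have h2 : Tendsto F (𝓝[<] t) (𝓝 (F t)) :=
      (hF t ht).mono_left (nhdsWithin_le_of_mem (Icc_mem_nhdsLT hab))
    refine h2.congr' ?_
    filter_upwards [Ioo_mem_nhdsLT hab] with u hu using (h u hu).deriv.symm
  · exact (h t ⟨h1, h2⟩).hasDerivWithinAt

theorem StrictMonoOn.exists_continuousOn_inverse {τ : ℝ → ℝ} {α β : ℝ} (hαβ : α ≤ β)
    (hτ : StrictMonoOn τ (Icc α β)) (hc : ContinuousOn τ (Icc α β)) :
    ∃ X : ℝ → ℝ, ContinuousOn X (Icc (τ α) (τ β)) ∧ (∀ x ∈ Icc α β, X (τ x) = x) ∧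
      ∀ t ∈ Icc (τ α) (τ β), X t ∈ Icc α β ∧ τ (X t) = t := by
  have hsurj : ∀ t ∈ Icc (τ α) (τ β), ∃ x ∈ Icc α β, τ x = t :=
    fun t ht => intermediate_value_Icc hαβ hc ht
  choose! X hX hτX using hsurj
  have hmem : ∀ x ∈ Icc α β, τ x ∈ Icc (τ α) (τ β) := fun x hx =>
    ⟨hτ.monotoneOn ⟨le_rfl, hαβ⟩ hx hx.1, hτ.monotoneOn hx ⟨hαβ, le_rfl⟩ hx.2⟩
  have hleft : ∀ x ∈ Icc α β, X (τ x) = x := fun x hx =>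
    hτ.injOn (hX _ (hmem x hx)) hx (hτX _ (hmem x hx))
  refine ⟨X, ?_, hleft, fun t ht => ⟨hX t ht, hτX t ht⟩⟩
  rw [continuousOn_iff_isClosed]
  intro C hC
  refine ⟨τ '' (Icc α β ∩ C), ((isCompact_Icc.inter_right hC).image_of_continuousOn
    (hc.mono inter_subset_left)).isClosed, ?_⟩
  ext t
  constructor
  · rintro ⟨h1, h2⟩
    exact ⟨⟨X t, ⟨hX t h2, h1⟩, hτX t h2⟩, h2⟩
  · rintro ⟨⟨x, ⟨hx1, hx2⟩, rfl⟩, h2⟩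
    refine ⟨?_, h2⟩
    rw [mem_preimage, hleft x hx1]
    exact hx2

/-- Since `v' = h / v` and `σ h ≥ k`, the function `1 / v` is dominated by `σ v' / k`, and a
derivative of constant sign of a function continuous up to the ends is integrable. The sign `σ`
covers both ends of a half-orbit. -/
theorem integrableOn_inv_of_deriv_ge {v h : ℝ → ℝ} {α β k σ : ℝ} (hk : 0 < k)
    (hv : ContinuousOn v (Icc α β)) (hpos : ∀ x ∈ Ioo α β, 0 < v x)
    (hder : ∀ x ∈ Ioo α β, HasDerivAt v (h x / v x) x) (hh : ∀ x ∈ Ioo α β, k ≤ σ * h x) :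
    MeasureTheory.IntegrableOn (fun x => (v x)⁻¹) (Ioo α β) := by
  have h1 : MeasureTheory.IntegrableOn (fun x => σ * (h x / v x)) (Ioc α β) := by
    refine intervalIntegral.integrableOn_deriv_of_nonneg (g := fun x => σ * v x)
      (hv.const_smul σ) (fun x hx => (hder x hx).const_mul σ) fun x hx => ?_
    rw [← mul_div_assoc]
    exact div_nonneg (hk.le.trans (hh x hx)) (hpos x hx).le
  have h2 := (h1.mono_set Ioo_subset_Ioc_self).const_mul (k⁻¹)
  refine MeasureTheory.Integrable.mono' h2 ?_ ?_
  · exact ContinuousOn.aestronglyMeasurable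
      ((hv.mono Ioo_subset_Icc_self).inv₀ fun x hx => (hpos x hx).ne') measurableSet_Ioo
  · filter_upwards [MeasureTheory.ae_restrict_mem measurableSet_Ioo] with x hx
    have hvx := hpos x hx
    rw [Real.norm_eq_abs, abs_of_pos (inv_pos.2 hvx), ← mul_div_assoc, ← mul_div_assoc,
      inv_eq_one_div]
    refine div_le_div_of_nonneg_right ?_ hvx.le
    rw [inv_mul_eq_div, one_le_div hk]
    exact hh x hx

/-- Time is `τ = ∫ dx / v` with `v = √(2e)`, and the trajectory is its inverse. The signs of `g` at
the ends make `v v'` nonzero there, so the orbit leaves and reaches the axis in finite time. -/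
theorem HalfOrbit.exists_trajectory {f g : ℝ → ℝ} (hf : Continuous f) (hg : Continuous g)
    {x₁ x₂ : ℝ} (H : HalfOrbit f g x₁ x₂) (hg₁ : g x₁ < 0) (hg₂ : 0 < g x₂) :
    ∃ (T : ℝ) (γ : ℝ → ℝ × ℝ), 0 < T ∧ γ 0 = (x₁, 0) ∧ γ T = (x₂, 0) ∧
      ∀ t ∈ Icc 0 T, (γ t).1 ∈ Icc x₁ x₂ ∧
        HasDerivWithinAt γ (lienardField f g (γ t)) (Icc 0 T) t := by
  obtain ⟨hlt, e, he₁, he₂, hepos, hder⟩ := H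
  set v : ℝ → ℝ := fun x => √(2 * e x) with hv
  set h : ℝ → ℝ := fun x => -f x * v x - g x with hh
  have hec : ContinuousOn e (Icc x₁ x₂) := fun x hx => (hder x hx).continuousWithinAt
  have hvc : ContinuousOn v (Icc x₁ x₂) := (hec.const_smul (2 : ℝ)).sqrt
  have hhc : ContinuousOn h (Icc x₁ x₂) :=
    (hf.neg.continuousOn.mul hvc).sub hg.continuousOn
  have hv₁ : v x₁ = 0 := by simp [hv, he₁]
  have hv₂ : v x₂ = 0 := by simp [hv, he₂]
  have hvpos : ∀ x ∈ Ioo x₁ x₂, 0 < v x := fun x hx =>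
    Real.sqrt_pos.2 (mul_pos two_pos (hepos x hx))
  have hvder : ∀ x ∈ Ioo x₁ x₂, HasDerivAt v (h x / v x) x := by
    intro x hx
    have h1 := ((hder x (Ioo_subset_Icc_self hx)).hasDerivAt (Icc_mem_nhds hx.1 hx.2)).const_mul 2
    refine (h1.sqrt (mul_pos two_pos (hepos x hx)).ne').congr_deriv ?_
    rw [mul_div_mul_left _ _ two_ne_zero]
  have hx₁I : x₁ ∈ Icc x₁ x₂ := ⟨le_rfl, hlt.le⟩
  have hx₂I : x₂ ∈ Icc x₁ x₂ := ⟨hlt.le, le_rfl⟩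
  have hint : MeasureTheory.IntegrableOn (fun x => (v x)⁻¹) (Ioo x₁ x₂) := by
    obtain ⟨c, hc, hc'⟩ : ∃ c ∈ Ioo x₁ x₂, ∀ x ∈ Ioo x₁ c, -g x₁ / 2 ≤ 1 * h x := by
      have h1 : Tendsto h (𝓝[>] x₁) (𝓝 (h x₁)) :=
        (hhc x₁ hx₁I).mono_left (nhdsWithin_le_of_mem (Icc_mem_nhdsGT hlt))
      have h2 : -g x₁ / 2 < h x₁ := by simp only [hh, hv₁]; linarith
      obtain ⟨c, hc, hc'⟩ := mem_nhdsGT_iff_exists_Ioo_subset.1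
        (inter_mem (h1.eventually (lt_mem_nhds h2)) (Ioo_mem_nhdsGT hlt))
      have hcc : (x₁ + min c x₂) / 2 ∈ Ioo x₁ c ∧ (x₁ + min c x₂) / 2 < x₂ := by
        have := lt_min (mem_Ioi.1 hc) hlt
        have h3 := min_le_left c x₂
        have h4 := min_le_right c x₂
        exact ⟨⟨by linarith, by linarith⟩, by linarith⟩
      refine ⟨(x₁ + min c x₂) / 2, ⟨hcc.1.1, hcc.2⟩, fun x hx => ?_⟩
      have h5 : -g x₁ / 2 < h x := (hc' ⟨hx.1, hx.2.trans hcc.1.2⟩).1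
      linarith
    obtain ⟨d, hd, hd'⟩ : ∃ d ∈ Ioo x₁ x₂, ∀ x ∈ Ioo d x₂, g x₂ / 2 ≤ (-1) * h x := by
      have h1 : Tendsto h (𝓝[<] x₂) (𝓝 (h x₂)) :=
        (hhc x₂ hx₂I).mono_left (nhdsWithin_le_of_mem (Icc_mem_nhdsLT hlt))
      have h2 : h x₂ < -g x₂ / 2 := by simp only [hh, hv₂]; linarith
      obtain ⟨d, hd, hd'⟩ := mem_nhdsLT_iff_exists_Ioo_subset.1
        (inter_mem (h1.eventually (gt_mem_nhds h2)) (Ioo_mem_nhdsLT hlt))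
      have hdd : (x₂ + max d x₁) / 2 ∈ Ioo d x₂ ∧ x₁ < (x₂ + max d x₁) / 2 := by
        have := max_lt (mem_Iio.1 hd) hlt
        have h3 := le_max_left d x₁
        have h4 := le_max_right d x₁
        exact ⟨⟨by linarith, by linarith⟩, by linarith⟩
      refine ⟨(x₂ + max d x₁) / 2, ⟨hdd.2, hdd.1.2⟩, fun x hx => ?_⟩
      have h5 : h x < -g x₂ / 2 := (hd' ⟨hdd.1.1.trans hx.1, hx.2⟩).1
      linarith
    have i1 := integrableOn_inv_of_deriv_ge (v := v) (h := h) (by linarith : 0 < -g x₁ / 2)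
      (hvc.mono (Icc_subset_Icc_right hc.2.le)) (fun x hx => hvpos x ⟨hx.1, hx.2.trans hc.2⟩)
      (fun x hx => hvder x ⟨hx.1, hx.2.trans hc.2⟩) hc'
    have i2 := integrableOn_inv_of_deriv_ge (v := v) (h := h) (by linarith : 0 < g x₂ / 2)
      (hvc.mono (Icc_subset_Icc_left hd.1.le)) (fun x hx => hvpos x ⟨hd.1.trans hx.1, hx.2⟩)
      (fun x hx => hvder x ⟨hd.1.trans hx.1, hx.2⟩) hd'
    have i3 : MeasureTheory.IntegrableOn (fun x => (v x)⁻¹) (Icc c d) := by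
      refine ContinuousOn.integrableOn_compact isCompact_Icc ?_
      have hs : Icc c d ⊆ Ioo x₁ x₂ := fun x hx => ⟨hc.1.trans_le hx.1, hx.2.trans_lt hd.2⟩
      exact (hvc.mono (hs.trans Ioo_subset_Icc_self)).inv₀ fun x hx => (hvpos x (hs hx)).ne'
    refine ((i1.union i2).union i3).mono_set fun x hx => ?_
    rcases lt_or_ge x c with h1 | h1
    · exact Or.inl (Or.inl ⟨hx.1, h1⟩)
    rcases lt_or_ge d x with h2 | h2
    · exact Or.inl (Or.inr ⟨h2, hx.2⟩)
    · exact Or.inr ⟨h1, h2⟩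
  have hint' : MeasureTheory.IntegrableOn (fun x => (v x)⁻¹) (Icc x₁ x₂) := by
    rwa [integrableOn_Icc_iff_integrableOn_Ioo]
  set τ : ℝ → ℝ := fun x => ∫ z in x₁..x, (v z)⁻¹ with hτ
  have hτc : ContinuousOn τ (Icc x₁ x₂) := by
    have := intervalIntegral.continuousOn_primitive_interval (f := fun x => (v x)⁻¹)
      (a := x₁) (b := x₂) (μ := MeasureTheory.volume) (by rwa [uIcc_of_le hlt.le])
    rwa [uIcc_of_le hlt.le] at this
  have hτd : ∀ x ∈ Ioo x₁ x₂, HasDerivAt τ (v x)⁻¹ x := by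
    intro x hx
    have hca : ContinuousOn (fun x => (v x)⁻¹) (Ioo x₁ x₂) :=
      (hvc.mono Ioo_subset_Icc_self).inv₀ fun x hx => (hvpos x hx).ne'
    refine intervalIntegral.integral_hasDerivAt_right ?_
      (hca.stronglyMeasurableAtFilter isOpen_Ioo x hx) (hca.continuousAt (Ioo_mem_nhds hx.1 hx.2))
    rw [intervalIntegrable_iff_integrableOn_Icc_of_le hx.1.le]
    exact hint'.mono_set (Icc_subset_Icc_right hx.2.le)
  have hτm : StrictMonoOn τ (Icc x₁ x₂) := by
    refine strictMonoOn_of_deriv_pos (convex_Icc _ _) hτc fun x hx => ?_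
    rw [interior_Icc] at hx
    rw [(hτd x hx).deriv]
    exact inv_pos.2 (hvpos x hx)
  have hτ₁ : τ x₁ = 0 := intervalIntegral.integral_same
  obtain ⟨X, hXc, hXτ, hX⟩ := hτm.exists_continuousOn_inverse hlt.le hτc
  have hT : 0 < τ x₂ := by
    rw [← hτ₁]
    exact hτm hx₁I hx₂I hlt
  rw [hτ₁] at hXc hX
  have hX₁ : X 0 = x₁ := by rw [← hτ₁]; exact hXτ x₁ hx₁I
  have hX₂ : X (τ x₂) = x₂ := hXτ x₂ hx₂I
  have hXIoo : ∀ t ∈ Ioo 0 (τ x₂), X t ∈ Ioo x₁ x₂ := by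
    intro t ht
    obtain ⟨h1, h2⟩ := hX t (Ioo_subset_Icc_self ht)
    refine ⟨lt_of_le_of_ne h1.1 fun h => ?_, lt_of_le_of_ne h1.2 fun h => ?_⟩
    · rw [← h, hτ₁] at h2
      exact ht.1.ne h2
    · rw [h] at h2
      exact ht.2.ne' h2
  have hvX : ContinuousOn (fun t => v (X t)) (Icc 0 (τ x₂)) :=
    hvc.comp hXc fun t ht => (hX t ht).1
  refine ⟨τ x₂, fun t => (X t, v (X t)), hT, by simp [hX₁, hv₁], by simp [hX₂, hv₂],
    fun t ht => ⟨(hX t ht).1, ?_⟩⟩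
  refine hasDerivWithinAt_Icc_of_Ioo (F := fun t => lienardField f g (X t, v (X t))) hT
    (hXc.prodMk hvX) ?_ (fun t ht => ?_) t ht
  · exact hvX.prodMk (((hf.comp_continuousOn hXc).neg.mul hvX).sub (hg.comp_continuousOn hXc))
  · have hI := hXIoo t ht
    have h1 : HasDerivAt X (v (X t)) t := by
      rw [← inv_inv (v (X t))]
      refine HasDerivAt.of_local_left_inverse (hXc.continuousAt (Icc_mem_nhds ht.1 ht.2))
        (hτd _ hI) (inv_ne_zero (hvpos _ hI).ne') ?_
      filter_upwards [Ioo_mem_nhds ht.1 ht.2] with u hu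
      exact (hX u (Ioo_subset_Icc_self hu)).2
    have h2 : HasDerivAt (fun t => v (X t)) (-f (X t) * v (X t) - g (X t)) t := by
      refine ((hvder _ hI).comp t h1).congr_deriv ?_
      exact div_mul_cancel₀ _ (hvpos _ hI).ne'
    exact h1.prodMk h2

/-! ### Concatenation and periodic extension of trajectories. -/

section Gluing

variable {E : Type*} [NormedAddCommGroup E] [NormedSpace ℝ E]

/-- Away from the closed interval the derivative within it is unconstrained. This lets derivatives
on adjacent intervals be joined by `union` without locating `t`. -/
theorem hasDerivWithinAt_Icc_of_imp {γ : ℝ → E} {v : E} {a b t : ℝ}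
    (h : t ∈ Icc a b → HasDerivWithinAt γ v (Icc a b) t) : HasDerivWithinAt γ v (Icc a b) t := by
  by_cases ht : t ∈ Icc a b
  · exact h ht
  · refine HasFDerivWithinAt.of_notMem_closure ?_
    rwa [isClosed_Icc.closure_eq]

theorem HasDerivWithinAt.comp_sub_Icc {γ : ℝ → E} {v : E} {T c t : ℝ}
    (h : HasDerivWithinAt γ v (Icc 0 T) (t - c)) :
    HasDerivWithinAt (fun u => γ (u - c)) v (Icc c (c + T)) t := by
  have := HasDerivWithinAt.scomp t h ((hasDerivWithinAt_id t (Icc c (c + T))).sub_const c)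
    (fun u hu => by
      simp only [mem_Icc, id] at hu ⊢
      constructor <;> linarith [hu.1, hu.2])
  rwa [one_smul] at this

theorem exists_concat {F : E → E} {γ₁ γ₂ : ℝ → E} {T₁ T₂ : ℝ} (hT₁ : 0 ≤ T₁) (hT₂ : 0 ≤ T₂)
    (h₁ : ∀ t ∈ Icc 0 T₁, HasDerivWithinAt γ₁ (F (γ₁ t)) (Icc 0 T₁) t)
    (h₂ : ∀ t ∈ Icc 0 T₂, HasDerivWithinAt γ₂ (F (γ₂ t)) (Icc 0 T₂) t)
    (hglue : γ₁ T₁ = γ₂ 0) :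
    ∃ γ : ℝ → E, (∀ t ∈ Icc 0 T₁, γ t = γ₁ t) ∧
      (∀ t ∈ Icc T₁ (T₁ + T₂), γ t = γ₂ (t - T₁)) ∧
      ∀ t ∈ Icc 0 (T₁ + T₂), HasDerivWithinAt γ (F (γ t)) (Icc 0 (T₁ + T₂)) t := by
  set γ : ℝ → E := fun t => if t ≤ T₁ then γ₁ t else γ₂ (t - T₁) with hγ
  have e₁ : ∀ t ∈ Icc 0 T₁, γ t = γ₁ t := fun t ht => if_pos ht.2
  have e₂ : ∀ t ∈ Icc T₁ (T₁ + T₂), γ t = γ₂ (t - T₁) := by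
    intro t ht
    rcases ht.1.eq_or_lt with rfl | h
    · simp [hγ, hglue]
    · exact if_neg (not_le.2 h)
  refine ⟨γ, e₁, e₂, fun t _ => ?_⟩
  rw [← Icc_union_Icc_eq_Icc hT₁ (by linarith : T₁ ≤ T₁ + T₂)]
  refine (hasDerivWithinAt_Icc_of_imp fun ht => ?_).union
    (hasDerivWithinAt_Icc_of_imp fun ht => ?_)
  · rw [e₁ t ht]
    exact (h₁ t ht).congr e₁ (e₁ t ht)
  · rw [e₂ t ht]
    exact ((h₂ (t - T₁) ⟨by linarith [ht.1], by linarith [ht.2]⟩).comp_sub_Icc).congr e₂ (e₂ t ht)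

theorem exists_periodic_extension {F : E → E} {γ : ℝ → E} {T : ℝ} (hT : 0 < T)
    (h : ∀ t ∈ Icc 0 T, HasDerivWithinAt γ (F (γ t)) (Icc 0 T) t) (hclosed : γ 0 = γ T) :
    ∃ η : ℝ → E, Function.Periodic η T ∧ (∀ t ∈ Icc 0 T, η t = γ t) ∧
      (∀ t, ∃ u ∈ Icc 0 T, η t = γ u) ∧ ∀ t, HasDerivAt η (F (η t)) t := by
  set η : ℝ → E := fun t => γ (t - ⌊t / T⌋ * T) with hη
  have hfl : ∀ t : ℝ, (⌊t / T⌋ : ℝ) * T ≤ t ∧ t < (⌊t / T⌋ + 1 : ℝ) * T := fun t =>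
    ⟨(le_div_iff₀ hT).1 (Int.floor_le _), (div_lt_iff₀ hT).1 (Int.lt_floor_add_one _)⟩
  have hpiece : ∀ k : ℤ, ∀ t ∈ Icc (k * T) (k * T + T), η t = γ (t - k * T) := by
    intro k t ht
    rcases ht.2.lt_or_eq with h1 | h1
    · have : ⌊t / T⌋ = k := by
        rw [Int.floor_eq_iff, le_div_iff₀ hT, div_lt_iff₀ hT]
        exact ⟨ht.1, by linarith⟩
      simp only [hη, this]
    · have : ⌊t / T⌋ = k + 1 := by
        rw [h1, show (k : ℝ) * T + T = ((k + 1 : ℤ) : ℝ) * T by push_cast; ring,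
          mul_div_cancel_right₀ _ hT.ne', Int.floor_intCast]
      simp only [hη, this]
      rw [h1]
      push_cast
      rw [show (k : ℝ) * T + T - (k + 1) * T = 0 by ring, show (k : ℝ) * T + T - k * T = T by ring,
        hclosed]
  refine ⟨η, fun t => ?_, fun t ht => ?_, fun t => ⟨_, ?_, rfl⟩, fun t => ?_⟩
  · simp only [hη]
    rw [add_div, div_self hT.ne', Int.floor_add_one]
    push_cast
    congr 1
    ring
  · simpa using hpiece 0 t (by simpa using ht)
  · obtain ⟨h1, h2⟩ := hfl t
    exact ⟨by linarith, by linarith⟩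
  have hd : ∀ k : ℤ, HasDerivWithinAt η (F (η t)) (Icc (k * T) (k * T + T)) t := by
    refine fun k => hasDerivWithinAt_Icc_of_imp fun ht => ?_
    rw [hpiece k t ht]
    exact ((h (t - k * T) ⟨by linarith [ht.1], by linarith [ht.2]⟩).comp_sub_Icc).congr
      (hpiece k) (hpiece k t ht)
  obtain ⟨h1, h2⟩ := hfl t
  set k := ⌊t / T⌋ with hk
  -- The preceding period is included because `t` may be the left end `k * T`.
  have hu := (hd (k - 1)).union (hd k)
  have e : ((k - 1 : ℤ) : ℝ) * T + T = k * T := by push_cast; ring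
  rw [e, Icc_union_Icc_eq_Icc (by linarith) (by linarith)] at hu
  exact hu.hasDerivAt (Icc_mem_nhds (by linarith) (by linarith))

end Gluing

/-! ### Closing up: a fixed point of the return map. -/

/-- Two half-orbits that close up form a periodic solution. -/
theorem exists_periodic_of_halfOrbits {f g : ℝ → ℝ} (hf : Continuous f) (hg : Continuous g)
    {x₁ x₂ : ℝ} (H : HalfOrbit f g x₁ x₂)
    (H' : HalfOrbit (fun x => f (-x)) (fun x => -g (-x)) (-x₂) (-x₁))
    (hg₁ : g x₁ < 0) (hg₂ : 0 < g x₂) :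
    ∃ (γ : ℝ → ℝ × ℝ) (T : ℝ), 0 < T ∧ Function.Periodic γ T ∧ (∃ t, γ t ≠ γ 0) ∧
      ∀ t, (γ t).1 ∈ Icc x₁ x₂ ∧ HasDerivAt γ (lienardField f g (γ t)) t := by
  obtain ⟨T₁, γ₁, hT₁, h10, h11, h1⟩ := H.exists_trajectory hf hg hg₁ hg₂
  obtain ⟨T₂, γ₂, hT₂, h20, h21, h2⟩ := H'.exists_trajectory (hf.comp continuous_neg)
    (hg.comp continuous_neg).neg (by simpa using hg₂) (by simpa using hg₁)
  obtain ⟨γ, e₁, e₂, hγ⟩ := exists_concat (F := lienardField f g) (γ₂ := fun t => -γ₂ t)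
    hT₁.le hT₂.le (fun t ht => (h1 t ht).2) (fun t ht => by
      refine (h2 t ht).2.neg.congr_deriv ?_
      ext
      · simp [lienardField]
      · simp [lienardField]
        ring) (by simp [h11, h20])
  have hγ0 : γ 0 = (x₁, 0) := by rw [e₁ 0 ⟨le_rfl, hT₁.le⟩, h10]
  have hγ1 : γ T₁ = (x₂, 0) := by rw [e₁ T₁ ⟨hT₁.le, le_rfl⟩, h11]
  have hγ2 : γ (T₁ + T₂) = (x₁, 0) := by
    rw [e₂ _ ⟨by linarith, le_rfl⟩, add_sub_cancel_left, h21]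
    simp
  obtain ⟨η, hper, hη, hηu, hηd⟩ := exists_periodic_extension (by linarith : 0 < T₁ + T₂) hγ
    (hγ0.trans hγ2.symm)
  refine ⟨η, T₁ + T₂, by linarith, hper, ⟨T₁, ?_⟩, fun t => ⟨?_, hηd t⟩⟩
  · rw [hη T₁ ⟨hT₁.le, by linarith⟩, hη 0 ⟨le_rfl, by linarith⟩, hγ0, hγ1]
    intro h
    exact H.1.ne' (congrArg Prod.fst h)
  · obtain ⟨u, hu, hηu⟩ := hηu t
    rw [hηu]
    rcases le_total u T₁ with h | h
    · rw [e₁ u ⟨hu.1, h⟩]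
      exact (h1 u ⟨hu.1, h⟩).1
    · rw [e₂ u ⟨h, hu.2⟩]
      have := (h2 (u - T₁) ⟨by linarith, by linarith [hu.2]⟩).1
      simp only [Prod.fst_neg]
      exact ⟨by linarith [this.2], by linarith [this.1]⟩

/-- Knaster–Tarski: the supremum of the points with `x ≤ P x` is fixed. Continuity is not needed,
and the half-return maps are not known to have it. -/
theorem MonotoneOn.exists_fixedPoint_Icc {P : ℝ → ℝ} {α β : ℝ} (hαβ : α ≤ β)
    (hP : MonotoneOn P (Icc α β)) (hmaps : MapsTo P (Icc α β) (Icc α β)) :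
    ∃ x ∈ Icc α β, P x = x := by
  set S : Set ℝ := {x | x ∈ Icc α β ∧ x ≤ P x} with hS
  have hSb : BddAbove S := ⟨β, fun x hx => hx.1.2⟩
  have hα : α ∈ S := ⟨⟨le_rfl, hαβ⟩, (hmaps ⟨le_rfl, hαβ⟩).1⟩
  have hmem : sSup S ∈ Icc α β := ⟨le_csSup hSb hα, csSup_le ⟨α, hα⟩ fun x hx => hx.1.2⟩
  have h1 : sSup S ≤ P (sSup S) := csSup_le ⟨α, hα⟩ fun x hx =>
    hx.2.trans (hP hx.1 hmem (le_csSup hSb hx))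
  exact ⟨sSup S, hmem, le_antisymm (le_csSup hSb ⟨hmaps hmem, hP hmem (hmaps hmem) h1⟩) h1⟩

theorem UpperArc.congr {f g f' g' X Y : ℝ → ℝ} {t₀ t₁ m₁ m₂ : ℝ}
    (A : UpperArc f g X Y t₀ t₁ m₁ m₂)
    (h : ∀ t ∈ Icc t₀ t₁, f' (X t) = f (X t) ∧ g' (X t) = g (X t)) :
    UpperArc f' g' X Y t₀ t₁ m₁ m₂ :=
  { A with
    deriv_Y := fun t ht => by
      rw [(h t ht).1, (h t ht).2]
      exact A.deriv_Y t ht }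

/-- The full return map `x ↦ -T' (-T x)` sends `[μ₁, m₁]` into `[μ₁, m₁']`, which lies in `[μ₁, m₁]`
because `m₁' ≤ m₁`. -/
theorem BarrierData.exists_periodic {f g G s X Y : ℝ → ℝ}
    {n₁ n₂ b₁ b₂ κ M ε xs t₀ t₁ t₂ m₁ m₂ m₁' : ℝ}
    (D : BarrierData f g G s n₁ n₂ b₁ b₂ κ M ε)
    (hneg : ∀ x < xs, g x < 0) (hpos : ∀ x, xs < x → 0 < g x)
    (A : UpperArc f g X Y t₀ t₁ m₁ m₂)
    (A' : UpperArc (fun x => f (-x)) (fun x => -g (-x)) (fun t => -X t) (fun t => -Y t)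
      t₁ t₂ (-m₂) (-m₁'))
    (hY : ∀ t ∈ Icc t₀ t₂, |Y t| ≤ 2 * M) (hn₁ : n₁ < m₁') (hm : m₁' ≤ m₁) (hm₁ : m₁ < xs)
    (hm₂ : xs < m₂) (hn₂ : m₂ < n₂) :
    ∃ (γ : ℝ → ℝ × ℝ) (T : ℝ), 0 < T ∧ Function.Periodic γ T ∧ (∃ t, γ t ≠ γ 0) ∧
      ∀ t, (γ t).1 ∈ Icc b₁ b₂ ∧ HasDerivAt γ (lienardField f g (γ t)) t := by
  have hGc : Continuous G := continuous_iff_continuousAt.2 fun x => (D.hasDerivAt_G x).continuousAt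
  have hq : 0 < M ^ 2 - ε ^ 2 := by nlinarith [D.ε_pos, D.ε_lt]
  have hε2 : 0 < ε ^ 2 := pow_pos D.ε_pos 2
  obtain ⟨μ₁, hμ₁, hG₁⟩ : ∃ x ∈ Ioo b₁ n₁, G x = G n₁ + (M ^ 2 - ε ^ 2) / 2 :=
    intermediate_value_Ioo' D.b₁_lt.le hGc.continuousOn
      ⟨by linarith, by linarith [D.level_left]⟩
  obtain ⟨μ₂, hμ₂, hG₂⟩ : ∃ x ∈ Ioo n₂ b₂, G x = G n₂ + (M ^ 2 - ε ^ 2) / 2 :=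
    intermediate_value_Ioo D.lt_b₂.le hGc.continuousOn
      ⟨by linarith, by linarith [D.level_right]⟩
  have hG₁' : G μ₁ - G n₁ = (M ^ 2 - ε ^ 2) / 2 := by linarith
  have hG₂' : G μ₂ - G n₂ = (M ^ 2 - ε ^ 2) / 2 := by linarith
  obtain ⟨T, hT, hTH⟩ := D.exists_half_return hμ₁.2 hμ₂.1 hG₁' hG₂' hneg A
    (fun t ht => (le_abs_self _).trans (hY t ⟨ht.1, ht.2.trans A'.lt.le⟩)) (by linarith) hm₁ hm₂
    hn₂
  obtain ⟨T', hT', hTH'⟩ := D.reflect.exists_half_return (μ₁ := -μ₂) (μ₂ := -μ₁) (xs := -xs)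
    (neg_lt_neg hμ₂.1) (neg_lt_neg hμ₁.2) (by simpa using hG₂') (by simpa using hG₁')
    (fun x hx => neg_lt_zero.2 (hpos _ (by linarith))) A'
    (fun t ht => (neg_le_abs _).trans (hY t ⟨A.lt.le.trans ht.1, ht.2⟩)) (neg_lt_neg hn₂)
    (neg_lt_neg hm₂) (by linarith) (neg_lt_neg hn₁)
  have hmapsT : ∀ x ∈ Icc μ₁ m₁, -T x ∈ Icc (-μ₂) (-m₂) := fun x hx =>
    ⟨neg_le_neg (hTH x hx).1.2, neg_le_neg (hTH x hx).1.1⟩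
  obtain ⟨x, hx, hfix⟩ := MonotoneOn.exists_fixedPoint_Icc (P := fun x => -T' (-T x))
    (α := μ₁) (β := m₁) (by linarith [hμ₁.2])
    (fun x hx y hy hxy => neg_le_neg (hT' (hmapsT x hx) (hmapsT y hy)
      (neg_le_neg (hT hx hy hxy))))
    (fun x hx => by
      obtain ⟨h1, h2⟩ := (hTH' _ (hmapsT x hx)).1
      exact ⟨by linarith, by linarith⟩)
  have hT'x : T' (-T x) = -x := by linarith [hfix]
  have H' := (hTH' _ (hmapsT x hx)).2
  rw [hT'x] at H'
  obtain ⟨h1, h2⟩ := (hTH x hx).1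
  obtain ⟨γ, S, hS, hper, hne, hγ⟩ := exists_periodic_of_halfOrbits D.continuous_f D.continuous_g
    (hTH x hx).2 H' (hneg x (by linarith [hx.2])) (hpos _ (by linarith))
  exact ⟨γ, S, hS, hper, hne, fun t => ⟨⟨by linarith [(hγ t).1.1, hx.1, hμ₁.1],
    by linarith [(hγ t).1.2, hμ₂.2]⟩, (hγ t).2⟩⟩

/-- On the axis `y' = -g`, so the polar angle crosses every multiple of `π` downwards and at most
once. Backwards in time it therefore tends to `+∞`, and the crossing times cut the trajectory into
upper and lower arcs. -/
theorem IsUnstableFocus.exists_loop {a : ℝ} {f g : ℝ → ℝ} {p : ℝ × ℝ}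
    (h : IsUnstableFocus a f g p) (hneg : ∀ x, a < x → x < p.1 → g x < 0)
    (hpos : ∀ x, p.1 < x → 0 < g x) {η : ℝ} (hη : 0 < η) :
    ∃ (X Y : ℝ → ℝ) (t₀ t₁ t₂ m₁ m₂ m₁' : ℝ),
      UpperArc f g X Y t₀ t₁ m₁ m₂ ∧
      UpperArc (fun x => f (-x)) (fun x => -g (-x)) (fun t => -X t) (fun t => -Y t)
        t₁ t₂ (-m₂) (-m₁') ∧
      m₁' ≤ m₁ ∧ m₁ < p.1 ∧ p.1 < m₂ ∧ ∀ t ∈ Icc t₀ t₂, |X t - p.1| < η ∧ |Y t| < η := by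
  have hp2 : p.2 = 0 := congrArg Prod.fst h.equilibrium.2
  obtain ⟨δ, hδ, H⟩ := h.spiral
  obtain ⟨γ, θ, hsol, -, hlim, hθc, hpol, hθlim⟩ := H (p + (δ / 2, 0))
    (fun h0 => by
      have := congrArg Prod.fst h0
      simp only [Prod.fst_add] at this
      linarith)
    (by
      rw [dist_eq_norm, add_sub_cancel_left, Prod.norm_def]
      simp only [norm_zero, Real.norm_eq_abs]
      rw [max_eq_left (abs_nonneg _), abs_of_pos (by linarith)]
      linarith)
  set X : ℝ → ℝ := fun t => (γ t).1 with hX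
  set Y : ℝ → ℝ := fun t => (γ t).2 with hY
  have hpol' : ∀ t ≤ 0, ∃ r, 0 < r ∧ X t = p.1 + r * Real.cos (θ t) ∧
      Y t = r * Real.sin (θ t) := by
    intro t ht
    obtain ⟨r, hr, e⟩ := hpol t ht
    exact ⟨r, hr, by simp [hX, e], by simp [hY, e, hp2]⟩
  have hγd : ∀ t < 0, HasDerivAt γ (lienardField f g (γ t)) t := fun t ht =>
    (hsol t ht.le).2.hasDerivAt (Iic_mem_nhds ht)
  have hXd : ∀ t < 0, HasDerivAt X (Y t) t := fun t ht =>
    (ContinuousLinearMap.fst ℝ ℝ ℝ).hasFDerivAt.comp_hasDerivAt t (hγd t ht)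
  have hYd : ∀ t < 0, HasDerivAt Y (-f (X t) * Y t - g (X t)) t := fun t ht =>
    (ContinuousLinearMap.snd ℝ ℝ ℝ).hasFDerivAt.comp_hasDerivAt t (hγd t ht)
  have hcross : ∀ s < 0, ∀ k : ℤ, θ s = k * Real.pi →
      (∀ᶠ u in 𝓝[<] s, k * Real.pi < θ u) ∧ ∀ᶠ u in 𝓝[>] s, θ u < k * Real.pi := by
    intro s hs k hk
    obtain ⟨r, hr, hXs, hYs⟩ := hpol' s hs.le
    rw [hk, Real.sin_int_mul_pi, mul_zero] at hYs
    rw [hk] at hXs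
    have hder : HasDerivAt (fun u => -(Real.cos (k * Real.pi) * Y u))
        (Real.cos (k * Real.pi) * g (X s)) s := by
      refine ((hYd s hs).const_mul (Real.cos (k * Real.pi))).neg.congr_deriv ?_
      rw [hYs]
      ring
    have hd0 : 0 < Real.cos (k * Real.pi) * g (X s) := by
      have hsq : Real.cos (k * Real.pi) ^ 2 = 1 := by
        have := Real.sin_sq_add_cos_sq (k * Real.pi)
        rw [Real.sin_int_mul_pi] at this
        linarith
      rcases sq_eq_one_iff.1 hsq with e | e
      · rw [e] at hXs ⊢
        rw [one_mul]
        exact hpos _ (by linarith)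
      · rw [e] at hXs ⊢
        have := hneg _ (hsol s hs.le).1 (by change X s < p.1; linarith)
        change g (X s) < 0 at this
        linarith
    have hnear : ∀ᶠ u in 𝓝 s, |θ u - k * Real.pi| < Real.pi ∧ u < 0 := by
      refine Eventually.and ?_ (Iio_mem_nhds hs)
      have hc : ContinuousAt θ s := hθc.continuousAt (Iic_mem_nhds hs)
      have hc' : ContinuousAt (fun u => |θ u - k * Real.pi|) s := by fun_prop
      refine hc'.eventually (gt_mem_nhds ?_)
      simp only [hk, sub_self, abs_zero]
      exact Real.pi_pos
    have hsin : ∀ u < 0, ∃ r, 0 < r ∧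
        Real.cos (k * Real.pi) * Y u = r * Real.sin (θ u - k * Real.pi) := by
      intro u hu
      obtain ⟨r, hr, -, e⟩ := hpol' u hu.le
      refine ⟨r, hr, ?_⟩
      rw [e, Real.sin_sub, Real.sin_int_mul_pi]
      ring
    constructor
    · filter_upwards [hder.hasDerivWithinAt.eventually_lt_left self_mem_nhdsWithin hd0,
        nhdsWithin_le_nhds hnear] with u hu hu'
      rw [hYs, mul_zero, neg_zero] at hu
      obtain ⟨r, hr, e⟩ := hsin u hu'.2
      by_contra hc
      have := Real.sin_nonpos_of_nonpos_of_neg_pi_le (x := θ u - k * Real.pi) (by linarith)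
        (abs_lt.1 hu'.1).1.le
      nlinarith
    · filter_upwards [hder.hasDerivWithinAt.eventually_gt_right self_mem_nhdsWithin hd0,
        nhdsWithin_le_nhds hnear] with u hu hu'
      rw [hYs, mul_zero, neg_zero] at hu
      obtain ⟨r, hr, e⟩ := hsin u hu'.2
      by_contra hc
      have := Real.sin_nonneg_of_nonneg_of_le_pi (x := θ u - k * Real.pi) (by linarith)
        (abs_lt.1 hu'.1).2.le
      nlinarith
  -- A level `kπ` cannot be reached from below, since just before any crossing the angle is above
  -- it.
  have hstay : ∀ k : ℤ, ∀ α β : ℝ, α ≤ β → β < 0 → θ α < k * Real.pi → θ β < k * Real.pi := by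
    intro k α β hαβ hβ hα
    have := pos_on_Icc_of_frequently_nonpos (d := fun u => k * Real.pi - θ u) (α := α) (β := β)
      (continuousOn_const.sub (hθc.mono fun u hu => hu.2.trans hβ.le)) (by linarith)
      (fun t ht hz => ?_) β ⟨hαβ, le_rfl⟩
    · linarith
    have hev := (hcross t (ht.2.trans_lt hβ) k (by linarith)).1
    exact (hev.mono fun u hu => by linarith).frequently
  have hafter : ∀ k : ℤ, ∀ s t : ℝ, θ s = k * Real.pi → s < t → t < 0 → θ t < k * Real.pi := by
    intro k s t hk hst ht
    obtain ⟨u, hu1, hu2⟩ :=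
      ((hcross s (hst.trans ht) k hk).2.and (Ioc_mem_nhdsGT hst)).exists
    exact hstay k u t hu2.2 ht hu1
  have hbefore : ∀ k : ℤ, ∀ s t : ℝ, θ s = k * Real.pi → t < s → s < 0 → k * Real.pi < θ t := by
    intro k s t hk hts hs
    by_contra hc
    rcases (not_lt.1 hc).lt_or_eq with h1 | h1
    · exact (hstay k t s hts.le hs h1).ne hk
    · exact (hafter k t s h1 hts hs).ne hk
  -- If the angle were very negative in the past, it would lie below the multiple of `π` just under
  -- `θ (-1)` and stay below it up to time `-1`.
  have hθtop : Tendsto θ atBot atTop := by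
    refine hθlim.congr' ?_
    filter_upwards [hθlim.eventually_ge_atTop (|θ (-1)| + 2 * Real.pi),
      eventually_le_atBot (-1 : ℝ)] with t ht ht1
    refine abs_of_nonneg ?_
    by_contra hc
    rw [abs_of_neg (not_le.1 hc)] at ht
    have h1 := Int.lt_floor_add_one (θ (-1) / Real.pi)
    rw [div_lt_iff₀ Real.pi_pos] at h1
    have h2 := Int.floor_le (θ (-1) / Real.pi)
    rw [le_div_iff₀ Real.pi_pos] at h2
    have h3 := neg_abs_le (θ (-1))
    have := hstay ⌊θ (-1) / Real.pi⌋ t (-1) ht1 (by norm_num) (by linarith [Real.pi_pos])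
    linarith
  have hlevel : ∀ t' < 0, ∀ k : ℤ, θ t' < k * Real.pi → ∃ s < t', θ s = k * Real.pi := by
    intro t' ht' k hk
    obtain ⟨t, ht1, ht2⟩ := ((hθtop.eventually_gt_atTop (k * Real.pi)).and
      (eventually_lt_atBot t')).exists
    obtain ⟨s, hs, e⟩ := intermediate_value_Ioo' ht2.le
      (hθc.mono fun u hu => hu.2.trans ht'.le) ⟨hk, ht1⟩
    exact ⟨s, hs.2, e⟩
  obtain ⟨t', ht'0, ht'⟩ : ∃ t' < 0, ∀ t ≤ t', dist (γ t) p < η := by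
    obtain ⟨b, hb⟩ := eventually_atBot.1 (hlim.eventually (Metric.ball_mem_nhds p hη))
    exact ⟨min b (-1), (min_le_right _ _).trans_lt (by norm_num),
      fun t ht => hb t (ht.trans (min_le_left _ _))⟩
  obtain ⟨k₀, hk₀⟩ := exists_nat_gt (θ t' / Real.pi)
  rw [div_lt_iff₀ Real.pi_pos] at hk₀
  -- These levels exceed `θ t'` because `k₀ * π` does, so they are crossed before `t'`. The offset
  -- `2 * k₀ + 1` is odd: even `n` gives points left of the focus, odd `n` points right of it.
  have hlev : ∀ n : ℕ, ∃ s < t', θ s = ((2 * k₀ + 1 + n : ℕ) : ℤ) * Real.pi := by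
    intro n
    refine hlevel t' ht'0 _ (hk₀.trans_le (mul_le_mul_of_nonneg_right ?_ Real.pi_pos.le))
    push_cast
    linarith [n.cast_nonneg (α := ℝ), k₀.cast_nonneg (α := ℝ)]
  choose s hst' hs using hlev
  have hs0 : ∀ n, s n < 0 := fun n => (hst' n).trans ht'0
  have hsucc : ∀ n, s (n + 1) < s n := by
    intro n
    by_contra hc
    have h1 := hs n
    have h2 := hs (n + 1)
    have h3 : ((2 * k₀ + 1 + n : ℕ) : ℤ) * Real.pi < ((2 * k₀ + 1 + (n + 1) : ℕ) : ℤ) * Real.pi := by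
      refine mul_lt_mul_of_pos_right ?_ Real.pi_pos
      push_cast
      linarith
    rcases (not_lt.1 hc).lt_or_eq with h4 | h4
    · linarith [hafter _ _ _ h1 h4 (hs0 _)]
    · rw [h4] at h1
      linarith
  have hodd : ∀ j : ℕ, X (s (2 * j)) < p.1 ∧ Y (s (2 * j)) = 0 := by
    intro j
    obtain ⟨r, hr, h1, h2⟩ := hpol' _ (hs0 (2 * j)).le
    rw [hs, Real.sin_int_mul_pi, mul_zero] at h2
    have h3 : (((2 * k₀ + 1 + 2 * j : ℕ) : ℤ) : ℝ) * Real.pi =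
        Real.pi + ((k₀ + j : ℕ) : ℝ) * (2 * Real.pi) := by
      push_cast
      ring
    rw [hs, h3, Real.cos_add_nat_mul_two_pi, Real.cos_pi] at h1
    exact ⟨by linarith, h2⟩
  have heven : ∀ j : ℕ, p.1 < X (s (2 * j + 1)) ∧ Y (s (2 * j + 1)) = 0 := by
    intro j
    obtain ⟨r, hr, h1, h2⟩ := hpol' _ (hs0 (2 * j + 1)).le
    rw [hs, Real.sin_int_mul_pi, mul_zero] at h2
    have h3 : (((2 * k₀ + 1 + (2 * j + 1) : ℕ) : ℤ) : ℝ) * Real.pi =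
        0 + ((k₀ + j + 1 : ℕ) : ℝ) * (2 * Real.pi) := by
      push_cast
      ring
    rw [hs, h3, Real.cos_add_nat_mul_two_pi, Real.cos_zero] at h1
    exact ⟨by linarith, h2⟩
  -- Otherwise the left crossings would move away from the focus as time goes to `-∞`, against
  -- convergence to it.
  obtain ⟨j, hj⟩ : ∃ j : ℕ, X (s (2 * j)) ≤ X (s (2 * (j + 1))) := by
    by_contra! hc
    have hmono : StrictAnti fun j : ℕ => X (s (2 * j)) := strictAnti_nat_of_succ_lt hc
    obtain ⟨b, hb⟩ := eventually_atBot.1 (hlim.eventually (Metric.ball_mem_nhds p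
      (sub_pos.2 (hodd 0).1)))
    obtain ⟨b', hb'⟩ : ∃ b' < 0, b' ≤ b := ⟨min b (-1), (min_le_right _ _).trans_lt (by norm_num),
      min_le_left _ _⟩
    obtain ⟨n, hn⟩ := exists_nat_gt (θ b' / Real.pi)
    rw [div_lt_iff₀ Real.pi_pos] at hn
    have h1 : s (2 * n) ≤ b' := by
      by_contra hcon
      have h2 := hbefore _ _ _ (hs (2 * n)) (not_le.1 hcon) (hs0 _)
      have h3 : (n : ℝ) * Real.pi ≤ ((2 * k₀ + 1 + 2 * n : ℕ) : ℤ) * Real.pi := by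
        refine mul_le_mul_of_nonneg_right ?_ Real.pi_pos.le
        push_cast
        linarith [n.cast_nonneg (α := ℝ), k₀.cast_nonneg (α := ℝ)]
      linarith
    have h2 : dist (γ (s (2 * n))) p < p.1 - X (s (2 * 0)) := hb _ (h1.trans hb'.2)
    have h3 : |X (s (2 * n)) - p.1| ≤ dist (γ (s (2 * n))) p := by
      rw [Prod.dist_eq, ← Real.dist_eq]
      exact le_max_left _ _
    have h4 := hmono.antitone (Nat.zero_le n)
    have h5 := neg_abs_le (X (s (2 * n)) - p.1)
    linarith
  have hc0 : ∀ {α β : ℝ}, β < 0 → Icc α β ⊆ Iio 0 := fun hβ u hu => hu.2.trans_lt hβ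
  refine ⟨X, Y, s (2 * (j + 1)), s (2 * j + 1), s (2 * j), X (s (2 * (j + 1))), X (s (2 * j + 1)),
    X (s (2 * j)), ⟨hsucc (2 * j + 1), fun t ht => (hXd t (hc0 (hs0 _) ht)).hasDerivWithinAt,
      fun t ht => (hYd t (hc0 (hs0 _) ht)).hasDerivWithinAt, rfl, rfl, (hodd (j + 1)).2,
      (heven j).2, fun t ht => ?_⟩,
    ⟨hsucc (2 * j), fun t ht => (hXd t (hc0 (hs0 _) ht)).neg.hasDerivWithinAt,
      fun t ht => ((hYd t (hc0 (hs0 _) ht)).neg.congr_deriv ?_).hasDerivWithinAt, rfl, rfl,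
      by simp [(heven j).2], by simp [(hodd j).2], fun t ht => ?_⟩, hj, (hodd (j + 1)).1,
    (heven j).1, fun t ht => ?_⟩
  · have ht0 : t < 0 := ht.2.trans (hs0 _)
    obtain ⟨r, hr, -, e⟩ := hpol' t ht0.le
    have h1 := hafter _ _ _ (hs (2 * (j + 1))) ht.1 ht0
    have h2 := hbefore _ _ _ (hs (2 * j + 1)) ht.2 (hs0 _)
    rw [e, ← Real.sin_sub_nat_mul_two_pi _ (k₀ + j + 1)]
    refine mul_pos hr (Real.sin_pos_of_pos_of_lt_pi ?_ ?_)
    · push_cast at h2 ⊢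
      linarith
    · push_cast at h1 ⊢
      linarith
  · simp only [neg_neg]
    ring
  · have ht0 : t < 0 := ht.2.trans (hs0 _)
    obtain ⟨r, hr, -, e⟩ := hpol' t ht0.le
    have h1 := hafter _ _ _ (hs (2 * j + 1)) ht.1 ht0
    have h2 := hbefore _ _ _ (hs (2 * j)) ht.2 (hs0 _)
    rw [e, ← Real.sin_sub_nat_mul_two_pi _ (k₀ + j + 1)]
    refine neg_pos.2 (mul_neg_of_pos_of_neg hr (Real.sin_neg_of_neg_of_neg_pi_lt ?_ ?_))
    · push_cast at h1 ⊢
      linarith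
    · push_cast at h2 ⊢
      linarith
  · have h1 := ht' t (ht.2.trans (hst' _).le)
    rw [Prod.dist_eq, max_lt_iff, Real.dist_eq, Real.dist_eq, hp2, sub_zero] at h1
    exact h1

/-! ### Construction of the transversal closed curve. -/

theorem exists_inverse_of_deriv_ge {h H : ℝ → ℝ} {c : ℝ} (hc : 0 < c) (hlow : ∀ x, c ≤ h x)
    (hder : ∀ x, HasDerivAt H (h x) x) :
    ∃ X : ℝ → ℝ, StrictMono X ∧ (∀ v, H (X v) = v) ∧ (∀ x, X (H x) = x) ∧
      ∀ v, HasDerivAt X (h (X v))⁻¹ v := by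
  have hmono : StrictMono H := strictMono_of_hasDerivAt_pos hder fun x => hc.trans_le (hlow x)
  have hcont : Continuous H := continuous_iff_continuousAt.2 fun x => (hder x).continuousAt
  have hm : Monotone fun x => H x - c * x :=
    monotone_of_hasDerivAt_nonneg (f' := fun x => h x - c)
      (fun x => ((hder x).sub ((hasDerivAt_id x).const_mul c)).congr_deriv (by simp))
      (fun x => by simpa using hlow x)
  have htop : Tendsto H atTop atTop := by
    refine tendsto_atTop_mono' atTop (f₁ := fun x => H 0 + c * x) ?_
      (tendsto_atTop_add_const_left _ _ (tendsto_id.const_mul_atTop hc))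
    filter_upwards [eventually_ge_atTop 0] with x hx
    have := hm hx
    simp only [mul_zero, sub_zero] at this
    linarith
  have hbot : Tendsto H atBot atBot := by
    have hlin : Tendsto (fun x : ℝ => H 0 + c * x) atBot atBot :=
      tendsto_atBot_add_const_left _ _ (tendsto_id.const_mul_atBot hc)
    refine tendsto_atBot_mono' atBot ?_ hlin
    filter_upwards [eventually_le_atBot 0] with x hx
    have := hm hx
    simp only [mul_zero, sub_zero] at this
    linarith
  set e := hmono.orderIsoOfSurjective H (hcont.surjective htop hbot) with he
  have hHe : ∀ v, H (e.symm v) = v := fun v => e.apply_symm_apply v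
  refine ⟨e.symm, e.symm.strictMono, hHe, fun x => e.symm_apply_apply x, fun v => ?_⟩
  exact HasDerivAt.of_local_left_inverse e.symm.continuous.continuousAt (hder _)
    (hc.trans_le (hlow _)).ne' (Eventually.of_forall hHe)

namespace BarrierData

variable {f g G s : ℝ → ℝ} {n₁ n₂ b₁ b₂ κ M ε : ℝ}

/-- The abscissa as a function of the potential increment `v`. With `v = (M² - w²) / 2` the outer
arc is parametrized by height, which keeps it smooth at its vertical tangent. -/
theorem exists_right_level (D : BarrierData f g G s n₁ n₂ b₁ b₂ κ M ε) :
    ∃ X X' : ℝ → ℝ, Continuous X' ∧ (∀ v, HasDerivAt X (X' v) v) ∧ X 0 = n₂ ∧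
      ∀ v, 0 ≤ v → n₂ ≤ X v ∧ G (X v) = G n₂ + v ∧ X' v * g (X v) = 1 := by
  obtain ⟨c, hc, -, hgc⟩ := D.g_bound
  -- Freezing `g` left of `n₂` makes its primitive a bijection of `ℝ`, so `X` is differentiable on
  -- the whole line, across `v = 0` included.
  set h : ℝ → ℝ := fun x => g (max x n₂) with hh
  have hhc : Continuous h := D.continuous_g.comp (continuous_id.max continuous_const)
  have hlow : ∀ x, c ≤ h x := fun x => hgc _ (le_max_right _ _)
  obtain ⟨X, hXm, hHX, hXH, hXd⟩ := exists_inverse_of_deriv_ge (H := fun x => ∫ z in n₂..x, h z)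
    hc hlow fun x => intervalIntegral.integral_hasDerivAt_right (hhc.intervalIntegrable _ _)
      hhc.stronglyMeasurable.stronglyMeasurableAtFilter hhc.continuousAt
  have hX0 : X 0 = n₂ := by
    have := hXH n₂
    rwa [intervalIntegral.integral_same] at this
  have hXc : Continuous X := continuous_iff_continuousAt.2 fun v => (hXd v).continuousAt
  refine ⟨X, fun v => (h (X v))⁻¹, (hhc.comp hXc).inv₀ fun v => (hc.trans_le (hlow _)).ne', hXd,
    hX0, fun v hv => ?_⟩
  have h1 : n₂ ≤ X v := by
    rw [← hX0]
    exact hXm.monotone hv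
  refine ⟨h1, ?_, ?_⟩
  · have h2 : ∫ z in n₂..X v, h z = G (X v) - G n₂ := by
      refine intervalIntegral.integral_eq_sub_of_hasDerivAt (fun z hz => ?_)
        (hhc.intervalIntegrable _ _)
      rw [uIcc_of_le h1] at hz
      simp only [hh, max_eq_left hz.1]
      exact D.hasDerivAt_G z
    have h3 := hHX v
    simp only [h2] at h3
    linarith
  · simp only [hh, max_eq_left h1]
    exact inv_mul_cancel₀ (D.g_right h1).ne'

theorem exists_left_level (D : BarrierData f g G s n₁ n₂ b₁ b₂ κ M ε) :
    ∃ X X' : ℝ → ℝ, Continuous X' ∧ (∀ v, HasDerivAt X (X' v) v) ∧ X 0 = n₁ ∧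
      ∀ v, 0 ≤ v → X v ≤ n₁ ∧ G (X v) = G n₁ + v ∧ X' v * g (X v) = 1 := by
  obtain ⟨X, X', hc, hd, h0, h⟩ := D.reflect.exists_right_level
  refine ⟨fun v => -X v, fun v => -X' v, hc.neg, fun v => (hd v).neg, by simp [h0], fun v hv => ?_⟩
  obtain ⟨h1, h2, h3⟩ := h v hv
  refine ⟨by linarith, by simpa using h2, ?_⟩
  linarith

end BarrierData

theorem exists_concat_arcs {E : Type*} (A : ℕ → ℝ → E) {n : ℕ} (hn : 0 < n)
    (hglue : ∀ i, i + 1 < n → A i 1 = A (i + 1) 0) :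
    ∃ c : ℝ → E, ∀ i < n, ∀ u ∈ Icc (0 : ℝ) 1, c ((i + u) / n) = A i u := by
  have hn' : (n : ℝ) ≠ 0 := by positivity
  -- At `s = 1` the floor is `n`; the minimum keeps the last arc there. At the other joints the
  -- floor selects the next arc and `hglue` applies.
  refine ⟨fun s => A (min ⌊n * s⌋₊ (n - 1)) (n * s - (min ⌊n * s⌋₊ (n - 1) : ℕ)),
    fun i hi u hu => ?_⟩
  have e : (n : ℝ) * ((i + u) / n) = i + u := by field_simp
  simp only [e]
  rcases hu.2.lt_or_eq with h | rfl
  · have hfl : ⌊(i : ℝ) + u⌋₊ = i := by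
      rw [Nat.floor_eq_iff (by have := hu.1; positivity)]
      exact ⟨by linarith [hu.1], by linarith⟩
    rw [hfl, min_eq_left (by omega), add_sub_cancel_left]
  · have hfl : ⌊(i : ℝ) + 1⌋₊ = i + 1 := by
      rw [← Nat.cast_add_one, Nat.floor_natCast]
    rw [hfl]
    rcases (Nat.succ_le_of_lt hi).lt_or_eq with h | h
    · rw [min_eq_left (by omega), hglue i h]
      simp
    · rw [min_eq_right (by omega), show n - 1 = i by omega, add_sub_cancel_left]

theorem exists_arc_param {n : ℕ} (hn : 0 < n) {s : ℝ} (hs : s ∈ Icc (0 : ℝ) 1) :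
    ∃ i < n, ∃ u ∈ Icc (0 : ℝ) 1, s = (i + u) / n := by
  have hn' : (0 : ℝ) < n := by positivity
  rcases hs.2.lt_or_eq with h | h
  · have h0 : 0 ≤ (n : ℝ) * s := mul_nonneg hn'.le hs.1
    refine ⟨⌊(n : ℝ) * s⌋₊, ?_, n * s - ⌊(n : ℝ) * s⌋₊, ⟨?_, ?_⟩, ?_⟩
    · rw [Nat.floor_lt h0]
      nlinarith
    · linarith [Nat.floor_le h0]
    · linarith [Nat.lt_floor_add_one ((n : ℝ) * s)]
    · field_simp
      ring
  · refine ⟨n - 1, by omega, 1, ⟨zero_le_one, le_rfl⟩, ?_⟩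
    rw [h, Nat.cast_sub hn]
    push_cast
    field_simp
    ring

/-- A closed curve assembled from finitely many transversal arcs, with an explicit left inverse `L`
of its parametrization. -/
theorem IsTransversalClosedCurve.of_arcs {a : ℝ} {f g : ℝ → ℝ} {c : ℝ → ℝ × ℝ} {n : ℕ}
    (hn : 0 < n) {A A' : ℕ → ℝ → ℝ × ℝ} (L : ℝ × ℝ → ℝ)
    (hc : ∀ i < n, ∀ u ∈ Icc (0 : ℝ) 1, c ((i + u) / n) = A i u)
    (hder : ∀ i < n, ∀ u, HasDerivAt (A i) (A' i u) u) (hcont : ∀ i < n, Continuous (A' i))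
    (hclosed : A 0 0 = A (n - 1) 1) (hmem : ∀ i < n, ∀ u ∈ Icc (0 : ℝ) 1, a < (A i u).1)
    (hL : ∀ i < n, ∀ u ∈ Icc (0 : ℝ) 1, (i : ℝ) + u < n → L (A i u) = (i + u) / n)
    (htrans : ∀ i < n, ∀ u ∈ Icc (0 : ℝ) 1,
      (A' i u).1 * (lienardField f g (A i u)).2 - (A' i u).2 * (lienardField f g (A i u)).1 < 0) :
    IsTransversalClosedCurve a f g c := by
  have hn' : (0 : ℝ) < n := by positivity
  have hsu : ∀ i : ℕ, ∀ s ∈ Icc ((i : ℝ) / n) ((i + 1 : ℝ) / n), (n : ℝ) * s - i ∈ Icc (0 : ℝ) 1 := by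
    intro i s hs
    have h1 := (div_le_iff₀ hn').1 hs.1
    have h2 := (le_div_iff₀ hn').1 hs.2
    constructor <;> linarith
  have hceq : ∀ i < n, ∀ s ∈ Icc ((i : ℝ) / n) ((i + 1 : ℝ) / n), c s = A i (n * s - i) := by
    intro i hi s hs
    rw [← hc i hi _ (hsu i s hs)]
    congr 1
    field_simp
    ring
  have hAd : ∀ i < n, ∀ s, HasDerivAt (fun s : ℝ => A i (n * s - i))
      ((n : ℝ) • A' i (n * s - i)) s := by
    intro i hi s
    have h1 : HasDerivAt (fun s : ℝ => (n : ℝ) * s - i) n s := by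
      simpa using ((hasDerivAt_id s).const_mul (n : ℝ)).sub_const (i : ℝ)
    exact HasDerivAt.scomp s (hder i hi _) h1
  have hcd : ∀ i < n, ∀ s ∈ Icc ((i : ℝ) / n) ((i + 1 : ℝ) / n),
      HasDerivWithinAt c ((n : ℝ) • A' i (n * s - i)) (Icc ((i : ℝ) / n) ((i + 1 : ℝ) / n)) s :=
    fun i hi s hs => (hAd i hi s).hasDerivWithinAt.congr (hceq i hi) (hceq i hi s hs)
  refine ⟨?_, ?_, ?_, ?_, n, fun i => (i : ℝ) / n, ?_, by simp, ?_, fun i => ?_⟩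
  · have hcc : ∀ m : ℕ, m ≤ n → ContinuousOn c (Icc 0 ((m : ℝ) / n)) := by
      intro m
      induction m with
      | zero => simp
      | succ m ih =>
        intro hm
        have h1 : ContinuousOn c (Icc ((m : ℝ) / n) ((m + 1 : ℝ) / n)) :=
          fun s hs => (hcd m (by omega) s hs).continuousWithinAt
        have h2 := (ih (by omega)).union_of_isClosed h1 isClosed_Icc isClosed_Icc
        rw [Icc_union_Icc_eq_Icc (by positivity)
          (div_le_div_of_nonneg_right (by linarith) hn'.le)] at h2
        push_cast
        exact h2
    have := hcc n le_rfl
    rwa [div_self hn'.ne'] at this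
  · have h0 := hc 0 hn 0 ⟨le_rfl, zero_le_one⟩
    have h1 := hc (n - 1) (by omega) 1 ⟨zero_le_one, le_rfl⟩
    rw [Nat.cast_sub hn, Nat.cast_one, sub_add_cancel, div_self hn'.ne'] at h1
    simp only [Nat.cast_zero, add_zero, zero_div] at h0
    rw [h0, h1, hclosed]
  · have hLc : ∀ s ∈ Ico (0 : ℝ) 1, L (c s) = s := by
      intro s hs
      obtain ⟨i, hi, u, hu, rfl⟩ := exists_arc_param hn (Ico_subset_Icc_self hs)
      rw [hc i hi u hu, hL i hi u hu]
      have := hs.2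
      rwa [div_lt_one hn'] at this
    intro s hs s' hs' h
    rw [← hLc s hs, h, hLc s' hs']
  · intro s hs
    obtain ⟨i, hi, u, hu, rfl⟩ := exists_arc_param hn hs
    rw [hc i hi u hu]
    exact hmem i hi u hu
  · intro i j hij
    exact div_lt_div_of_pos_right (by exact_mod_cast hij) hn'
  · simp [hn'.ne']
  · have hlt : (i : ℝ) / n < (i + 1 : ℝ) / n := div_lt_div_of_pos_right (by linarith) hn'
    simp only [Fin.val_castSucc, Fin.val_succ, Nat.cast_add, Nat.cast_one]
    refine ⟨?_, fun s hs => ?_⟩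
    · refine ContDiffOn.congr (ContDiff.contDiffOn ?_) (hceq i i.2)
      rw [contDiff_one_iff_deriv]
      refine ⟨fun s => (hAd i i.2 s).differentiableAt, ?_⟩
      have : deriv (fun s : ℝ => A i (n * s - i)) = fun s => (n : ℝ) • A' i (n * s - i) :=
        funext fun s => (hAd i i.2 s).deriv
      rw [this]
      have := hcont i i.2
      fun_prop
    · rw [(hcd i i.2 s hs).derivWithin (uniqueDiffOn_Icc hlt s hs), hceq i i.2 s hs]
      have := mul_neg_of_pos_of_neg hn' (htrans i i.2 _ (hsu i s hs))
      simp only [Prod.smul_fst, Prod.smul_snd, smul_eq_mul]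
      linarith

/-- Transversality of the outer arcs: `-y (y + ε) ≤ ε² / 4`, and `ε Q < 1` makes `ε² Q / 4` smaller
than `ε`. -/
theorem neg_mul_add_mul_sub_neg {y ε Q : ℝ} (hε : 0 < ε) (hQ : 0 < Q) (h : ε * Q < 1) :
    -(y * (y + ε)) * Q - ε < 0 := by
  have h1 : -(y * (y + ε)) ≤ ε ^ 2 / 4 := by nlinarith [sq_nonneg (2 * y + ε)]
  have h2 := mul_le_mul_of_nonneg_right h1 hQ.le
  nlinarith

theorem BarrierData.exists_transversal_curve {f g G s : ℝ → ℝ} {n₁ n₂ b₁ b₂ κ M ε : ℝ}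
    (D : BarrierData f g G s n₁ n₂ b₁ b₂ κ M ε) :
    ∃ (μ₁ μ₂ τ : ℝ) (c : ℝ → ℝ × ℝ), b₁ < μ₁ ∧ μ₁ < n₁ ∧ n₂ < μ₂ ∧
      IsTransversalClosedCurve b₁ f g c ∧ (∀ s ∈ Icc (0 : ℝ) 1, (c s).1 < b₂) ∧
      τ ∈ Ioo (0 : ℝ) 1 ∧ c 0 = (μ₁, 0) ∧ c τ = (μ₂, 0) ∧
      (∀ s ∈ Ioo 0 τ, 0 < (c s).2) ∧ (∀ s ∈ Ioo τ 1, (c s).2 < 0) := by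
  obtain ⟨Xl, Xl', hXlc, hXld, hXl0, hXl⟩ := D.exists_left_level
  obtain ⟨Xr, Xr', hXrc, hXrd, hXr0, hXr⟩ := D.exists_right_level
  have hε := D.ε_pos
  have hεM := D.ε_lt
  have hM := D.M_pos
  have hn := D.lt
  have hMp : 0 < M + ε := by linarith
  have hMm : 0 < M - ε := by linarith
  have hK : 0 < n₂ - n₁ := by linarith
  -- Five clockwise arcs: the left cap from `(μ₁, 0)` upwards, the top, the whole right cap, the
  -- bottom, and the left cap back up to the axis. The left cap is cut at `y = 0` so that the curve
  -- starts there.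
  set A : ℕ → ℝ → ℝ × ℝ := fun i u => match i with
    | 0 => (Xl ((M ^ 2 - ((M + ε) * u - ε) ^ 2) / 2), (M + ε) * u)
    | 1 => (n₁ + (n₂ - n₁) * u, s (n₁ + (n₂ - n₁) * u) + M)
    | 2 => (Xr ((M ^ 2 - (M - 2 * M * u) ^ 2) / 2), M - ε - 2 * M * u)
    | 3 => (n₂ - (n₂ - n₁) * u, s (n₂ - (n₂ - n₁) * u) - M)
    | _ => (Xl ((M ^ 2 - ((M - ε) * (u - 1) - ε) ^ 2) / 2), (M - ε) * (u - 1)) with hA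
  set A' : ℕ → ℝ → ℝ × ℝ := fun i u => match i with
    | 0 => (Xl' ((M ^ 2 - ((M + ε) * u - ε) ^ 2) / 2) * (-((M + ε) * u - ε) * (M + ε)), M + ε)
    | 1 => (n₂ - n₁, (κ - f (n₁ + (n₂ - n₁) * u)) * (n₂ - n₁))
    | 2 => (Xr' ((M ^ 2 - (M - 2 * M * u) ^ 2) / 2) * (-(M - 2 * M * u) * (-2 * M)), -2 * M)
    | 3 => (-(n₂ - n₁), (κ - f (n₂ - (n₂ - n₁) * u)) * (-(n₂ - n₁)))
    | _ => (Xl' ((M ^ 2 - ((M - ε) * (u - 1) - ε) ^ 2) / 2) *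
        (-((M - ε) * (u - 1) - ε) * (M - ε)), M - ε) with hA'
  have hlvl : ∀ w : ℝ, -M ≤ w → w ≤ M → 0 ≤ (M ^ 2 - w ^ 2) / 2 ∧ (M ^ 2 - w ^ 2) / 2 ≤ M ^ 2 / 2 :=
    fun w h1 h2 => ⟨by nlinarith, by nlinarith⟩
  have hsq : ∀ (w : ℝ → ℝ) (w' u : ℝ), HasDerivAt w w' u →
      HasDerivAt (fun u => (M ^ 2 - w u ^ 2) / 2) (-w u * w') u := by
    intro w w' u hw
    refine (((hw.pow 2).const_sub (M ^ 2)).div_const 2).congr_deriv ?_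
    push_cast
    ring
  have w0 : ∀ u, HasDerivAt (fun u => (M + ε) * u - ε) (M + ε) u := fun u => by
    simpa using ((hasDerivAt_id u).const_mul (M + ε)).sub_const ε
  have w1 : ∀ u, HasDerivAt (fun u => n₁ + (n₂ - n₁) * u) (n₂ - n₁) u := fun u => by
    simpa using ((hasDerivAt_id u).const_mul (n₂ - n₁)).const_add n₁
  have w2 : ∀ u, HasDerivAt (fun u => M - 2 * M * u) (-2 * M) u := fun u => by
    simpa using ((hasDerivAt_id u).const_mul (2 * M)).const_sub M
  have w3 : ∀ u, HasDerivAt (fun u => n₂ - (n₂ - n₁) * u) (-(n₂ - n₁)) u := fun u => by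
    simpa using ((hasDerivAt_id u).const_mul (n₂ - n₁)).const_sub n₂
  have w4 : ∀ u, HasDerivAt (fun u => (M - ε) * (u - 1) - ε) (M - ε) u := fun u => by
    simpa using (((hasDerivAt_id u).sub_const 1).const_mul (M - ε)).sub_const ε
  have hder : ∀ i < 5, ∀ u, HasDerivAt (A i) (A' i u) u := by
    intro i hi u
    interval_cases i
    · exact ((hXld _).comp u (hsq _ _ u (w0 u))).prodMk (by simpa using (w0 u).add_const ε)
    · exact (w1 u).prodMk (((D.hasDerivAt_s _).comp u (w1 u)).add_const M)
    · exact ((hXrd _).comp u (hsq _ _ u (w2 u))).prodMk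
        (((w2 u).sub_const ε).congr_of_eventuallyEq (Eventually.of_forall fun v => by ring))
    · exact (w3 u).prodMk (((D.hasDerivAt_s _).comp u (w3 u)).sub_const M)
    · exact ((hXld _).comp u (hsq _ _ u (w4 u))).prodMk (by simpa using (w4 u).add_const ε)
  have hcont : ∀ i < 5, Continuous (A' i) := by
    have hf := D.continuous_f
    intro i hi
    interval_cases i <;> simp only [hA'] <;> fun_prop
  have hglue : ∀ i, i + 1 < 5 → A i 1 = A (i + 1) 0 := by
    intro i hi
    have hi' : i < 4 := by omega
    interval_cases i
    · ext <;> simp [hA, D.s_left, hXl0]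
      ring
    · ext <;> simp [hA, D.s_right, hXr0]
      ring
    · have e : M - 2 * M = -M := by ring
      ext
      · simp [hA, e, hXr0]
      · simp [hA, D.s_right]
        ring
    · ext <;> simp [hA, D.s_left, hXl0]
  obtain ⟨c, hc⟩ := exists_concat_arcs A (by norm_num : 0 < 5) hglue
  have hlevl : ∀ v, 0 ≤ v → v ≤ M ^ 2 / 2 → b₁ < Xl v := by
    intro v h0 hv
    by_contra hcon
    have h1 := D.G_strictAntiOn.antitoneOn (mem_Iic.2 (hXl v h0).1) (mem_Iic.2 D.b₁_lt.le)
      (not_lt.1 hcon)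
    linarith [(hXl v h0).2.1, D.level_left]
  have hlevr : ∀ v, 0 ≤ v → v ≤ M ^ 2 / 2 → Xr v < b₂ := by
    intro v h0 hv
    by_contra hcon
    have h1 := D.G_strictMonoOn.monotoneOn (mem_Ici.2 D.lt_b₂.le) (mem_Ici.2 (hXr v h0).1)
      (not_lt.1 hcon)
    linarith [(hXr v h0).2.1, D.level_right]
  have r0 : ∀ u ∈ Icc (0 : ℝ) 1, -M ≤ (M + ε) * u - ε ∧ (M + ε) * u - ε ≤ M := fun u hu =>
    ⟨by nlinarith [hu.1], by nlinarith [hu.2]⟩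
  have r1 : ∀ u ∈ Icc (0 : ℝ) 1, n₁ + (n₂ - n₁) * u ∈ Icc n₁ n₂ := fun u hu =>
    ⟨by nlinarith [hu.1], by nlinarith [hu.2]⟩
  have r2 : ∀ u ∈ Icc (0 : ℝ) 1, -M ≤ M - 2 * M * u ∧ M - 2 * M * u ≤ M := fun u hu =>
    ⟨by nlinarith [hu.2], by nlinarith [hu.1]⟩
  have r3 : ∀ u ∈ Icc (0 : ℝ) 1, n₂ - (n₂ - n₁) * u ∈ Icc n₁ n₂ := fun u hu =>
    ⟨by nlinarith [hu.2], by nlinarith [hu.1]⟩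
  have r4 : ∀ u ∈ Icc (0 : ℝ) 1, -M ≤ (M - ε) * (u - 1) - ε ∧ (M - ε) * (u - 1) - ε ≤ M :=
    fun u hu => ⟨by nlinarith [hu.1], by nlinarith [hu.2]⟩
  have hstrip : ∀ i < 5, ∀ u ∈ Icc (0 : ℝ) 1, b₁ < (A i u).1 ∧ (A i u).1 < b₂ := by
    have hb₁ := D.b₁_lt
    have hb₂ := D.lt_b₂
    intro i hi u hu
    interval_cases i
    · obtain ⟨h1, h2⟩ := hlvl _ (r0 u hu).1 (r0 u hu).2
      exact ⟨hlevl _ h1 h2, (hXl _ h1).1.trans_lt (hn.trans hb₂)⟩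
    · exact ⟨hb₁.trans_le (r1 u hu).1, (r1 u hu).2.trans_lt hb₂⟩
    · obtain ⟨h1, h2⟩ := hlvl _ (r2 u hu).1 (r2 u hu).2
      exact ⟨(hb₁.trans hn).trans_le (hXr _ h1).1, hlevr _ h1 h2⟩
    · exact ⟨hb₁.trans_le (r3 u hu).1, (r3 u hu).2.trans_lt hb₂⟩
    · obtain ⟨h1, h2⟩ := hlvl _ (r4 u hu).1 (r4 u hu).2
      exact ⟨hlevl _ h1 h2, (hXl _ h1).1.trans_lt (hn.trans hb₂)⟩
  have hleft : ∀ v y : ℝ, 0 ≤ v →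
      Xl' v * (-(y - ε)) * (-f (Xl v) * y - g (Xl v)) - y < 0 := by
    intro v y hv
    obtain ⟨h1, -, h3⟩ := hXl v hv
    have hg := D.g_left h1
    have hX' : 0 < -Xl' v := by nlinarith
    have hf := D.f_left _ h1
    have hr := mul_lt_mul_of_pos_right (D.ratio_left _ h1) hX'
    have := neg_mul_add_mul_sub_neg (y := -y) hε (mul_pos hf hX') (by linarith)
    refine lt_of_eq_of_lt ?_ this
    linear_combination (y - ε) * h3
  have hright : ∀ v y : ℝ, 0 ≤ v →
      Xr' v * (y + ε) * (-f (Xr v) * y - g (Xr v)) + y < 0 := by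
    intro v y hv
    obtain ⟨h1, -, h3⟩ := hXr v hv
    have hg := D.g_right h1
    have hX' : 0 < Xr' v := by nlinarith
    have hf := D.f_right _ h1
    have hr := mul_lt_mul_of_pos_right (D.ratio_right _ h1) hX'
    have := neg_mul_add_mul_sub_neg (y := y) hε (mul_pos hf hX') (by linarith)
    refine lt_of_eq_of_lt ?_ this
    linear_combination -(y + ε) * h3
  have htrans : ∀ i < 5, ∀ u ∈ Icc (0 : ℝ) 1,
      (A' i u).1 * (lienardField f g (A i u)).2 - (A' i u).2 * (lienardField f g (A i u)).1 < 0 := by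
    intro i hi u hu
    interval_cases i <;> simp only [hA, hA', lienardField]
    · have := mul_neg_of_pos_of_neg hMp (hleft _ ((M + ε) * u) (hlvl _ (r0 u hu).1 (r0 u hu).2).1)
      linarith
    · have h1 := D.mid _ (r1 u hu)
      set x := n₁ + (n₂ - n₁) * u with hx
      have h2 := mul_le_mul_of_nonneg_left (neg_abs_le (s x)) D.κ_pos.le
      have h3 : 0 < (n₂ - n₁) * (g x + κ * (s x + M)) :=
        mul_pos hK (by linarith [neg_abs_le (g x)])
      linarith
    · have := mul_neg_of_pos_of_neg (mul_pos two_pos hM)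
        (hright _ (M - ε - 2 * M * u) (hlvl _ (r2 u hu).1 (r2 u hu).2).1)
      linarith
    · have h1 := D.mid _ (r3 u hu)
      set x := n₂ - (n₂ - n₁) * u with hx
      have h2 := mul_le_mul_of_nonneg_left (le_abs_self (s x)) D.κ_pos.le
      have h3 : 0 < (n₂ - n₁) * (-g x - κ * (s x - M)) :=
        mul_pos hK (by linarith [le_abs_self (g x)])
      linarith
    · have := mul_neg_of_pos_of_neg hMm
        (hleft _ ((M - ε) * (u - 1)) (hlvl _ (r4 u hu).1 (r4 u hu).2).1)
      linarith
  have hsM : ∀ x ∈ Icc n₁ n₂, 0 < s x + M ∧ s x - M < 0 := fun x hx => by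
    have := abs_lt.1 (D.abs_s_lt hx)
    exact ⟨by linarith, by linarith⟩
  -- Recovers the parameter from the point: from the height on the caps, from the abscissa on the
  -- top and bottom. It proves that the curve is simple.
  set L : ℝ × ℝ → ℝ := fun q => if q.1 ≤ n₁ then
      (if 0 ≤ q.2 then q.2 / (5 * (M + ε)) else 1 + q.2 / (5 * (M - ε)))
    else if n₂ ≤ q.1 then 2 / 5 + (M - ε - q.2) / (10 * M)
    else if 0 < q.2 then 1 / 5 + (q.1 - n₁) / (5 * (n₂ - n₁))
    else 3 / 5 + (n₂ - q.1) / (5 * (n₂ - n₁)) with hLdef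
  have hL0 : ∀ u ∈ Icc (0 : ℝ) 1, L (A 0 u) = (0 + u) / 5 := by
    intro u hu
    have h1 := (hXl _ (hlvl _ (r0 u hu).1 (r0 u hu).2).1).1
    have h2 : 0 ≤ (M + ε) * u := mul_nonneg hMp.le hu.1
    simp only [hLdef, hA, if_pos h1, if_pos h2]
    field_simp
    ring
  have hL2 : ∀ u ∈ Icc (0 : ℝ) 1, L (A 2 u) = (2 + u) / 5 := by
    intro u hu
    have h1 := (hXr _ (hlvl _ (r2 u hu).1 (r2 u hu).2).1).1
    simp only [hLdef, hA, if_pos h1, if_neg (not_le.2 (hn.trans_le h1))]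
    field_simp
    ring
  have hL4 : ∀ u ∈ Ico (0 : ℝ) 1, L (A 4 u) = (4 + u) / 5 := by
    intro u hu
    have hu' := Ico_subset_Icc_self hu
    have h1 := (hXl _ (hlvl _ (r4 u hu').1 (r4 u hu').2).1).1
    have h2 : (M - ε) * (u - 1) < 0 := mul_neg_of_pos_of_neg hMm (by linarith [hu.2])
    simp only [hLdef, hA, if_pos h1, if_neg (not_le.2 h2)]
    field_simp
    ring
  have hL : ∀ i < (5 : ℕ), ∀ u ∈ Icc (0 : ℝ) 1, (i : ℝ) + u < (5 : ℕ) →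
      L (A i u) = (i + u) / (5 : ℕ) := by
    intro i hi u hu hlt
    interval_cases i
    · simpa using hL0 u hu
    · rcases hu.1.eq_or_lt with rfl | h0
      · rw [← hglue 0 (by norm_num), hL0 1 ⟨zero_le_one, le_rfl⟩]
        norm_num
      rcases hu.2.eq_or_lt with rfl | h1
      · rw [hglue 1 (by norm_num), hL2 0 ⟨le_rfl, zero_le_one⟩]
        norm_num
      have h2 : ¬ (n₁ + (n₂ - n₁) * u ≤ n₁) := by nlinarith
      have h3 : ¬ (n₂ ≤ n₁ + (n₂ - n₁) * u) := by nlinarith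
      simp only [hLdef, hA, if_neg h2, if_neg h3, if_pos (hsM _ (r1 u hu)).1]
      push_cast
      field_simp
      ring
    · simpa using hL2 u hu
    · rcases hu.1.eq_or_lt with rfl | h0
      · rw [← hglue 2 (by norm_num), hL2 1 ⟨zero_le_one, le_rfl⟩]
        norm_num
      rcases hu.2.eq_or_lt with rfl | h1
      · rw [hglue 3 (by norm_num), hL4 0 ⟨le_rfl, zero_lt_one⟩]
        norm_num
      have h2 : ¬ (n₂ - (n₂ - n₁) * u ≤ n₁) := by nlinarith
      have h3 : ¬ (n₂ ≤ n₂ - (n₂ - n₁) * u) := by nlinarith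
      simp only [hLdef, hA, if_neg h2, if_neg h3, if_neg (not_lt.2 (hsM _ (r3 u hu)).2.le)]
      push_cast
      field_simp
      ring
    · have h1 : u < 1 := by
        push_cast at hlt
        linarith
      simpa using hL4 u ⟨hu.1, h1⟩
  have hclosed : A 0 0 = A (5 - 1) 1 := by
    ext <;> simp [hA]
  have hq : 0 < (M ^ 2 - ε ^ 2) / 2 := by nlinarith
  have hqM : (M ^ 2 - ε ^ 2) / 2 ≤ M ^ 2 / 2 := by nlinarith
  -- The parameter at which the right cap crosses `y = 0`.
  have hu₀ : (M - ε) / (2 * M) ∈ Ioo (0 : ℝ) 1 :=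
    ⟨by positivity, by rw [div_lt_one (by positivity)]; linarith⟩
  have hMu : 2 * M * ((M - ε) / (2 * M)) = M - ε := by field_simp
  refine ⟨Xl ((M ^ 2 - ε ^ 2) / 2), Xr ((M ^ 2 - ε ^ 2) / 2), (2 + (M - ε) / (2 * M)) / 5, c,
    hlevl _ hq.le hqM, lt_of_le_of_ne (hXl _ hq.le).1 fun h => ?_,
    lt_of_le_of_ne (hXr _ hq.le).1 fun h => ?_,
    IsTransversalClosedCurve.of_arcs (by norm_num : 0 < 5) L hc hder hcont hclosed
      (fun i hi u hu => (hstrip i hi u hu).1) hL htrans, ?_, ⟨?_, ?_⟩, ?_, ?_, ?_, ?_⟩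
  · have := (hXl _ hq.le).2.1
    rw [h] at this
    linarith
  · have := (hXr _ hq.le).2.1
    rw [← h] at this
    linarith
  · intro t ht
    obtain ⟨i, hi, u, hu, rfl⟩ := exists_arc_param (by norm_num : 0 < 5) ht
    rw [hc i hi u hu]
    exact (hstrip i hi u hu).2
  · linarith [hu₀.1]
  · linarith [hu₀.2]
  · have := hc 0 (by norm_num) 0 ⟨le_rfl, zero_le_one⟩
    simpa [hA] using this
  · have := hc 2 (by norm_num) ((M - ε) / (2 * M)) (Ioo_subset_Icc_self hu₀)
    push_cast at this
    rw [this]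
    simp only [hA, hMu]
    ext <;> simp
  · intro t ht
    obtain ⟨i, hi, u, hu, rfl⟩ := exists_arc_param (by norm_num : 0 < 5)
      (⟨ht.1.le, by linarith [ht.2, hu₀.2]⟩ : t ∈ Icc (0 : ℝ) 1)
    rw [hc i hi u hu]
    obtain ⟨ht1, ht2⟩ := ht
    push_cast at ht1 ht2
    interval_cases i <;> push_cast at ht1 ht2
    · exact mul_pos hMp (by linarith)
    · exact (hsM _ (r1 u hu)).1
    · have : 2 * M * u < 2 * M * ((M - ε) / (2 * M)) :=
        mul_lt_mul_of_pos_left (by linarith) (by positivity)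
      change 0 < M - ε - 2 * M * u
      linarith
    · linarith [hu.1, hu₀.2]
    · linarith [hu.1, hu₀.2]
  · intro t ht
    obtain ⟨i, hi, u, hu, rfl⟩ := exists_arc_param (by norm_num : 0 < 5)
      (⟨by linarith [ht.1, hu₀.1], ht.2.le⟩ : t ∈ Icc (0 : ℝ) 1)
    rw [hc i hi u hu]
    obtain ⟨ht1, ht2⟩ := ht
    push_cast at ht1 ht2
    interval_cases i <;> push_cast at ht1 ht2
    · linarith [hu.2, hu₀.1]
    · linarith [hu.2, hu₀.1]
    · have : 2 * M * ((M - ε) / (2 * M)) < 2 * M * u :=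
        mul_lt_mul_of_pos_left (by linarith) (by positivity)
      change M - ε - 2 * M * u < 0
      linarith
    · exact (hsM _ (r3 u hu)).2
    · exact mul_neg_of_pos_of_neg hMm (by linarith)

/-! ### Choice of the barrier constants. -/

/-- The constants depend on one another in the order `n₁, n₂`, then `M`, then `b₁, b₂` (potential
exceeding `M² / 2`), then `ε` (from bounds of `f / g` out to `b₁, b₂`), then `κ`. -/
theorem exists_barrierData {a ν₁ x₀ ν₂ : ℝ} {f g : ℝ → ℝ}
    (haν : a < ν₁) (hν₁ : ν₁ ≤ x₀) (hν₂ : x₀ ≤ ν₂)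
    (hf : ContinuousOn f (Ioi a)) (hg : ContinuousOn g (Ioi a))
    (hga : Tendsto g (𝓝[>] a) atBot) (hgtop : Tendsto g atTop atTop)
    (hGa : Tendsto (fun x => ∫ z in x₀..x, g z) (𝓝[>] a) atTop)
    (hGtop : Tendsto (fun x => ∫ z in x₀..x, g z) atTop atTop)
    (hfpos : ∀ x ∈ Ioo a ν₁ ∪ Ioi ν₂, 0 < f x)
    (hfint : (∫ x in ν₂..ν₁, f x) ≤ 0) :
    ∃ (f' g' G s : ℝ → ℝ) (n₁ n₂ b₁ b₂ κ M ε : ℝ), a < b₁ ∧ n₁ < ν₁ ∧ ν₂ < n₂ ∧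
      BarrierData f' g' G s n₁ n₂ b₁ b₂ κ M ε ∧
      ∀ x ∈ Icc b₁ b₂, f' x = f x ∧ g' x = g x := by
  obtain ⟨n₁, han₁, hn₁ν, hgn₁⟩ : ∃ n₁, a < n₁ ∧ n₁ < ν₁ ∧ ∀ x, a < x → x ≤ n₁ → g x < 0 := by
    obtain ⟨c, hc, hc'⟩ := mem_nhdsGT_iff_exists_Ioo_subset.1 (hga.eventually_lt_atBot 0)
    have h1 := lt_min (mem_Ioi.1 hc) haν
    have h2 := min_le_left c ν₁
    have h3 := min_le_right c ν₁
    exact ⟨(a + min c ν₁) / 2, by linarith, by linarith,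
      fun x hx hx' => hc' ⟨hx, by linarith⟩⟩
  obtain ⟨n₂, hνn₂, hgn₂⟩ : ∃ n₂, ν₂ < n₂ ∧ ∀ x, n₂ ≤ x → 0 < g x := by
    obtain ⟨c, hc⟩ := eventually_atTop.1 (hgtop.eventually_gt_atTop 0)
    exact ⟨max c ν₂ + 1, by linarith [le_max_right c ν₂],
      fun x hx => hc x (by linarith [le_max_left c ν₂])⟩
  have hL : 0 < n₂ - n₁ := by linarith
  have hsubI : ∀ {u v : ℝ}, a < u → a < v → uIcc u v ⊆ Ioi a := fun hu hv z hz =>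
    (lt_min hu hv).trans_le hz.1
  have hfi : ∀ {u v : ℝ}, a < u → a < v → IntervalIntegrable f MeasureTheory.volume u v :=
    fun hu hv => (hf.mono (hsubI hu hv)).intervalIntegrable
  have hgi : ∀ {u v : ℝ}, a < u → a < v → IntervalIntegrable g MeasureTheory.volume u v :=
    fun hu hv => (hg.mono (hsubI hu hv)).intervalIntegrable
  set Φ := ∫ x in n₁..n₂, f x with hΦ
  have hΦ0 : 0 < Φ := by
    have h1 : 0 < ∫ x in n₁..ν₁, f x :=
      intervalIntegral.intervalIntegral_pos_of_pos_on (hfi han₁ haν)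
        (fun x hx => hfpos x (Or.inl ⟨han₁.trans hx.1, hx.2⟩)) hn₁ν
    have h2 : 0 < ∫ x in ν₂..n₂, f x :=
      intervalIntegral.intervalIntegral_pos_of_pos_on (hfi (by linarith) (by linarith))
        (fun x hx => hfpos x (Or.inr hx.1)) hνn₂
    have h3 := intervalIntegral.integral_add_adjacent_intervals
      (hfi han₁ haν) (hfi haν (by linarith : a < ν₂))
    have h4 := intervalIntegral.integral_add_adjacent_intervals
      (hfi han₁ (by linarith : a < ν₂)) (hfi (by linarith : a < ν₂) (by linarith : a < n₂))
    rw [intervalIntegral.integral_symm] at hfint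
    linarith
  have hmidI : Icc n₁ n₂ ⊆ Ioi a := fun x hx => han₁.trans_le hx.1
  obtain ⟨K, hK⟩ := isCompact_Icc.exists_bound_of_continuousOn (hg.mono hmidI)
  obtain ⟨B, hB⟩ := isCompact_Icc.exists_bound_of_continuousOn (hf.mono hmidI)
  have hn₁I : n₁ ∈ Icc n₁ n₂ := ⟨le_rfl, by linarith⟩
  have hK0 : 0 ≤ K := (norm_nonneg _).trans (hK n₁ hn₁I)
  have hB0 : 0 ≤ B := (norm_nonneg _).trans (hB n₁ hn₁I)
  -- `M` must be fixed before `ε`, hence before `κ`; `κ₀` is a lower bound of `κ` valid for every `ε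
  -- ≤ Φ / 4`. In `M`, the part `1 + Φ + B (n₂ - n₁)` bounds `|s|`, and `K / κ₀ + 1` leaves `κ (M -
  -- |s|) > K ≥ |g|`.
  set κ₀ := Φ / (2 * (n₂ - n₁)) with hκ₀
  have hκ₀0 : 0 < κ₀ := by positivity
  set M := 1 + Φ + B * (n₂ - n₁) + K / κ₀ + 1 with hM
  have hM1 : 1 < M := by
    have : 0 ≤ B * (n₂ - n₁) := by positivity
    have : 0 ≤ K / κ₀ := by positivity
    linarith
  obtain ⟨b₁, hb₁, hGb₁⟩ : ∃ b₁ ∈ Ioo a n₁, M ^ 2 / 2 + ∫ z in x₀..n₁, g z < ∫ z in x₀..b₁, g z :=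
    ((Filter.Eventually.and (Ioo_mem_nhdsGT han₁) (hGa.eventually_gt_atTop _))).exists
  obtain ⟨b₂, hb₂, hGb₂⟩ : ∃ b₂, n₂ < b₂ ∧ M ^ 2 / 2 + ∫ z in x₀..n₂, g z < ∫ z in x₀..b₂, g z :=
    ((eventually_gt_atTop n₂).and (hGtop.eventually_gt_atTop _)).exists
  have hlI : Icc b₁ n₁ ⊆ Ioi a := fun x hx => hb₁.1.trans_le hx.1
  have hrI : Icc n₂ b₂ ⊆ Ioi a := fun x hx => by
    rw [mem_Ioi]
    linarith [hx.1]
  have hgl : ∀ x ∈ Icc b₁ n₁, g x < 0 := fun x hx => hgn₁ x (hlI hx) hx.2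
  have hgr : ∀ x ∈ Icc n₂ b₂, 0 < g x := fun x hx => hgn₂ x hx.1
  obtain ⟨Q₁, hQ₁⟩ := isCompact_Icc.exists_bound_of_continuousOn
    ((hf.mono hlI).div (hg.mono hlI) fun x hx => (hgl x hx).ne)
  obtain ⟨Q₂, hQ₂⟩ := isCompact_Icc.exists_bound_of_continuousOn
    ((hf.mono hrI).div (hg.mono hrI) fun x hx => (hgr x hx).ne')
  obtain ⟨z₁, hz₁, hz₁'⟩ := isCompact_Icc.exists_isMaxOn ⟨n₁, hb₁.2.le, le_rfl⟩ (hg.mono hlI)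
  obtain ⟨z₂, hz₂, hz₂'⟩ := isCompact_Icc.exists_isMinOn ⟨n₂, le_rfl, hb₂.le⟩ (hg.mono hrI)
  set Q := max (max Q₁ Q₂) 0 with hQ
  have hQ0 : 0 ≤ Q := le_max_right _ _
  set ε := min (Φ / 4) (min 1 (1 / (Q + 1))) with hεdef
  have hε : 0 < ε := lt_min (by positivity) (lt_min one_pos (by positivity))
  have hεΦ : ε ≤ Φ / 4 := min_le_left _ _
  have hε1 : ε ≤ 1 := (min_le_right _ _).trans (min_le_left _ _)
  have hεQ : ε * Q < 1 := by
    have h1 : ε ≤ 1 / (Q + 1) := (min_le_right _ _).trans (min_le_right _ _)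
    rw [le_div_iff₀ (by linarith)] at h1
    linarith
  set κ := (Φ - 2 * ε) / (n₂ - n₁) with hκ
  -- This value of `κ` makes `s` drop by exactly `2ε` over `[n₁, n₂]`.
  have hκL : κ * (n₂ - n₁) = Φ - 2 * ε := by
    rw [hκ]
    field_simp
  have hκκ₀ : κ₀ ≤ κ := by
    rw [hκ₀, hκ, div_le_div_iff₀ (by positivity) hL]
    nlinarith
  have hκ0 : 0 < κ := hκ₀0.trans_le hκκ₀
  -- Composing with the projection onto `[b₁, b₂]` extends `f` and `g` continuously to `ℝ` and keeps
  -- their signs and ratio bounds outside `[n₁, n₂]`.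
  set cl : ℝ → ℝ := fun x => max b₁ (min x b₂) with hcl
  have hclc : Continuous cl := by fun_prop
  have hcla : ∀ x, cl x ∈ Ioi a := fun x => hb₁.1.trans_le (le_max_left _ _)
  have hcleq : ∀ x ∈ Icc b₁ b₂, cl x = x := fun x hx => by
    simp only [hcl, min_eq_left hx.2, max_eq_right hx.1]
  have hcll : ∀ x ≤ n₁, cl x ∈ Icc b₁ n₁ := fun x hx =>
    ⟨le_max_left _ _, max_le hb₁.2.le ((min_le_left _ _).trans hx)⟩
  have hclr : ∀ x, n₂ ≤ x → cl x ∈ Icc n₂ b₂ := fun x hx =>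
    ⟨(le_min hx hb₂.le).trans (le_max_right _ _), max_le (by linarith [hb₁.2]) (min_le_right _ _)⟩
  set f' : ℝ → ℝ := fun x => f (cl x) with hf'
  set g' : ℝ → ℝ := fun x => g (cl x) with hg'
  have hf'c : Continuous f' := hf.comp_continuous hclc hcla
  have hg'c : Continuous g' := hg.comp_continuous hclc hcla
  have hn₁b : n₁ ∈ Icc b₁ b₂ := ⟨hb₁.2.le, by linarith⟩
  have hfeq : ∀ x ∈ Icc b₁ b₂, ∫ z in n₁..x, f' z = ∫ z in n₁..x, f z := fun x hx =>
    intervalIntegral.integral_congr fun z hz => by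
      simp only [hf', hcleq z (uIcc_subset_Icc hn₁b hx hz)]
  have hgeq : ∀ x ∈ Icc b₁ b₂, ∀ y ∈ Icc b₁ b₂, ∫ z in y..x, g' z = ∫ z in y..x, g z :=
    fun x hx y hy => intervalIntegral.integral_congr fun z hz => by
      simp only [hg', hcleq z (uIcc_subset_Icc hy hx hz)]
  have hGdiff : ∀ x ∈ Icc b₁ b₂, ∀ y ∈ Icc b₁ b₂,
      (∫ z in n₁..x, g' z) - ∫ z in n₁..y, g' z = (∫ z in x₀..x, g z) - ∫ z in x₀..y, g z := by
    intro x hx y hy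
    have hxa : a < x := hb₁.1.trans_le hx.1
    have hya : a < y := hb₁.1.trans_le hy.1
    have hx₀a : a < x₀ := by linarith
    rw [intervalIntegral.integral_interval_sub_left (hg'c.intervalIntegrable _ _)
      (hg'c.intervalIntegrable _ _), hgeq x hx y hy,
      intervalIntegral.integral_interval_sub_left (hgi hx₀a hxa) (hgi hx₀a hya)]
  refine ⟨f', g', fun x => ∫ z in n₁..x, g' z, fun x => ε + κ * (x - n₁) - ∫ z in n₁..x, f' z,
    n₁, n₂, b₁, b₂, κ, M, ε, hb₁.1, hn₁ν, hνn₂, ?_, fun x hx => by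
      simp only [hf', hg', hcleq x hx, and_self]⟩
  exact
    { continuous_f := hf'c
      continuous_g := hg'c
      hasDerivAt_G := fun x => (hg'c.integral_hasStrictDerivAt n₁ x).hasDerivAt
      hasDerivAt_s := fun x => by
        have h1 : HasDerivAt (fun x => ε + κ * (x - n₁)) κ x := by
          simpa using (((hasDerivAt_id x).sub_const n₁).const_mul κ).const_add ε
        exact h1.sub (hf'c.integral_hasStrictDerivAt n₁ x).hasDerivAt
      s_left := by simp
      s_right := by
        rw [hfeq n₂ ⟨by linarith [hb₁.2], hb₂.le⟩, hκL]
        linarith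
      lt := by linarith
      κ_pos := hκ0
      ε_pos := hε
      ε_lt := by linarith
      g_bound := by
        refine ⟨min (-g z₁) (g z₂), lt_min (by linarith [hgl z₁ hz₁]) (hgr z₂ hz₂), ?_, ?_⟩
        · intro x hx
          have h1 : g (cl x) ≤ g z₁ := hz₁' (hcll x hx)
          have h2 := min_le_left (-g z₁) (g z₂)
          change g (cl x) ≤ _
          linarith
        · intro x hx
          exact (min_le_right _ _).trans (hz₂' (hclr x hx))
      f_left := fun x hx => hfpos _ (Or.inl ⟨hcla x, (hcll x hx).2.trans_lt hn₁ν⟩)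
      f_right := fun x hx => hfpos _ (Or.inr (hνn₂.trans_le (hclr x hx).1))
      ratio_left := fun x hx => by
        have h1 := hQ₁ _ (hcll x hx)
        have h2 := hgl _ (hcll x hx)
        rw [Pi.div_apply, norm_div, Real.norm_eq_abs, Real.norm_eq_abs, abs_of_neg h2,
          div_le_iff₀ (by linarith)] at h1
        have h3 : Q₁ ≤ Q := (le_max_left _ _).trans (le_max_left _ _)
        have h4 : Q₁ * -g (cl x) ≤ Q * -g (cl x) :=
          mul_le_mul_of_nonneg_right h3 (by linarith)
        change ε * f (cl x) < -g (cl x)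
        nlinarith [le_abs_self (f (cl x))]
      ratio_right := fun x hx => by
        have h1 := hQ₂ _ (hclr x hx)
        have h2 := hgr _ (hclr x hx)
        rw [Pi.div_apply, norm_div, Real.norm_eq_abs, Real.norm_eq_abs, abs_of_pos h2,
          div_le_iff₀ h2] at h1
        have h3 : Q₂ ≤ Q := (le_max_right _ _).trans (le_max_left _ _)
        have h4 : Q₂ * g (cl x) ≤ Q * g (cl x) := mul_le_mul_of_nonneg_right h3 h2.le
        change ε * f (cl x) < g (cl x)
        nlinarith [le_abs_self (f (cl x))]
      mid := fun x hx => by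
        have hxb : x ∈ Icc b₁ b₂ := ⟨by linarith [hx.1, hb₁.2], by linarith [hx.2]⟩
        have h1 : |∫ z in n₁..x, f z| ≤ B * (n₂ - n₁) := by
          have := intervalIntegral.norm_integral_le_of_norm_le_const (a := n₁) (b := x) (f := f)
            (C := B) fun z hz => hB z (by
              rw [uIoc_of_le hx.1] at hz
              exact ⟨hz.1.le, hz.2.trans hx.2⟩)
          rw [Real.norm_eq_abs, abs_of_nonneg (by linarith [hx.1] : 0 ≤ x - n₁)] at this
          exact this.trans (mul_le_mul_of_nonneg_left (by linarith [hx.2]) hB0)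
        have h2 : κ * (x - n₁) ≤ κ * (n₂ - n₁) :=
          mul_le_mul_of_nonneg_left (by linarith [hx.2]) hκ0.le
        have h3 : 0 ≤ κ * (x - n₁) := mul_nonneg hκ0.le (by linarith [hx.1])
        rw [hfeq x hxb]
        have h4 : |ε + κ * (x - n₁) - ∫ z in n₁..x, f z| ≤ 1 + Φ + B * (n₂ - n₁) := by
          rw [abs_le] at h1 ⊢
          constructor <;> linarith [h1.1, h1.2]
        have h5 : |g' x| ≤ K := by
          simp only [hg', hcleq x hxb]
          exact hK x hx
        have h6 : κ₀ * (K / κ₀ + 1) = K + κ₀ := by field_simp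
        have h7 : κ₀ * (K / κ₀ + 1) ≤ κ * (K / κ₀ + 1) :=
          mul_le_mul_of_nonneg_right hκκ₀ (by positivity)
        have h8 : κ * (K / κ₀ + 1) ≤ κ * (M - |ε + κ * (x - n₁) - ∫ z in n₁..x, f z|) :=
          mul_le_mul_of_nonneg_left (by linarith) hκ0.le
        linarith
      b₁_lt := hb₁.2
      lt_b₂ := hb₂
      level_left := by
        rw [hGdiff b₁ ⟨le_rfl, by linarith [hb₁.2]⟩ n₁ hn₁b]
        linarith
      level_right := by
        rw [hGdiff b₂ ⟨by linarith [hb₁.2], le_rfl⟩ n₂ ⟨by linarith [hb₁.2], hb₂.le⟩]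
        linarith }

/-! ### Return to the original system and the theorem. -/

theorem IsTransversalClosedCurve.congr {a a' : ℝ} {f g f' g' : ℝ → ℝ} {c : ℝ → ℝ × ℝ}
    (h : IsTransversalClosedCurve a f g c) (ha : a' ≤ a)
    (hfg : ∀ s ∈ Icc (0 : ℝ) 1, f (c s).1 = f' (c s).1 ∧ g (c s).1 = g' (c s).1) :
    IsTransversalClosedCurve a' f' g' c where
  continuousOn := h.continuousOn
  closed := h.closed
  simple := h.simple
  mem_phase s hs := ha.trans_lt (h.mem_phase s hs)
  arcs := by
    obtain ⟨n, t, ht, ht0, ht1, H⟩ := h.arcs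
    refine ⟨n, t, ht, ht0, ht1, fun i => ⟨(H i).1, fun s hs => ?_⟩⟩
    have hs01 : s ∈ Icc (0 : ℝ) 1 := by
      rw [← ht0, ← ht1]
      exact ⟨(ht.monotone (Fin.zero_le _)).trans hs.1, hs.2.trans (ht.monotone (Fin.le_last _))⟩
    have := (H i).2 s hs
    simpa only [lienardField, (hfg s hs01).1, (hfg s hs01).2] using this

theorem sign_of_unique_equilibrium {a : ℝ} {f g : ℝ → ℝ} {p : ℝ × ℝ}
    (hg : ContinuousOn g (Ioi a)) (hga : Tendsto g (𝓝[>] a) atBot)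
    (hgtop : Tendsto g atTop atTop) (hp : IsEquilibrium a f g p)
    (huniq : ∀ q, IsEquilibrium a f g q → q = p) :
    (∀ x, a < x → x < p.1 → g x < 0) ∧ ∀ x, p.1 < x → 0 < g x := by
  have hzero : ∀ x, a < x → g x = 0 → x = p.1 := fun x hx h =>
    congrArg Prod.fst (huniq (x, 0) ⟨hx, by ext <;> simp [lienardField, h]⟩)
  constructor
  · intro x hx hxp
    by_contra hc
    obtain ⟨u, hu, hgu⟩ := (Filter.Eventually.and (Ioo_mem_nhdsGT hx)
      (hga.eventually_lt_atBot 0)).exists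
    obtain ⟨z, hz, hgz⟩ := intermediate_value_Icc hu.2.le
      (hg.mono fun z hz => hu.1.trans_le hz.1) ⟨hgu.le, not_lt.1 hc⟩
    have := hzero z (hu.1.trans_le hz.1) hgz
    linarith [hz.2]
  · intro x hxp
    have hx : a < x := hp.1.trans hxp
    by_contra hc
    obtain ⟨u, hu, hgu⟩ := ((eventually_gt_atTop x).and (hgtop.eventually_gt_atTop 0)).exists
    obtain ⟨z, hz, hgz⟩ := intermediate_value_Icc hu.le
      (hg.mono fun z hz => hx.trans_le hz.1) ⟨not_lt.1 hc, hgu.le⟩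
    have := hzero z (hx.trans_le hz.1) hgz
    linarith [hz.1]

theorem theorem3 (a ν₁ x₀ ν₂ : ℝ) (f g : ℝ → ℝ)
    (haν : a < ν₁) (hν₁ : ν₁ ≤ x₀) (hν₂ : x₀ ≤ ν₂)
    (hf : ContinuousOn f (Ioi a)) (hg : ContinuousOn g (Ioi a))
    (hga : Tendsto g (𝓝[>] a) atBot) (hgtop : Tendsto g atTop atTop)
    (hGa : Tendsto (fun x => ∫ z in x₀..x, g z) (𝓝[>] a) atTop)
    (hGtop : Tendsto (fun x => ∫ z in x₀..x, g z) atTop atTop)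
    (hfpos : ∀ x ∈ Ioo a ν₁ ∪ Ioi ν₂, 0 < f x)
    (hfint : (∫ x in ν₂..ν₁, f x) ≤ 0) :
    (∃ (μ₁ μ₂ τ : ℝ) (c : ℝ → ℝ × ℝ),
      a < μ₁ ∧ μ₁ < ν₁ ∧ ν₂ < μ₂ ∧
      IsTransversalClosedCurve a f g c ∧
      τ ∈ Ioo (0 : ℝ) 1 ∧ c 0 = (μ₁, 0) ∧ c τ = (μ₂, 0) ∧
      (∀ s ∈ Ioo 0 τ, 0 < (c s).2) ∧ (∀ s ∈ Ioo τ 1, (c s).2 < 0)) ∧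
    ((∃ p : ℝ × ℝ, IsUnstableFocus a f g p ∧ ∀ q, IsEquilibrium a f g q → q = p) →
      ∃ γ : ℝ → ℝ × ℝ, IsCycle a f g γ) := by
  obtain ⟨f', g', G, s, n₁, n₂, b₁, b₂, κ, M, ε, hab₁, hn₁ν, hνn₂, D, hfg⟩ :=
    exists_barrierData haν hν₁ hν₂ hf hg hga hgtop hGa hGtop hfpos hfint
  have hb₁n := D.b₁_lt
  have hnb₂ := D.lt_b₂
  have hn := D.lt
  constructor
  · obtain ⟨μ₁, μ₂, τ, c, hμ₁, hμn, hnμ, hc, hcb, hτ, hc0, hcτ, hup, hlow⟩ :=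
      D.exists_transversal_curve
    refine ⟨μ₁, μ₂, τ, c, hab₁.trans hμ₁, hμn.trans hn₁ν, hνn₂.trans hnμ,
      hc.congr hab₁.le fun s hs => hfg _ ⟨(hc.mem_phase s hs).le, (hcb s hs).le⟩,
      hτ, hc0, hcτ, hup, hlow⟩
  · rintro ⟨p, hp, huniq⟩
    obtain ⟨hneg, hpos⟩ := sign_of_unique_equilibrium hg hga hgtop hp.equilibrium huniq
    have hap := hp.equilibrium.1
    have hgp : g p.1 = 0 := by
      have h1 : p.2 = 0 := congrArg Prod.fst hp.equilibrium.2
      have h2 : -f p.1 * p.2 - g p.1 = 0 := congrArg Prod.snd hp.equilibrium.2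
      rw [h1] at h2
      linarith
    -- The sign change of `g` at the unique equilibrium places it strictly between `n₁` and `n₂`.
    have hn₁p : n₁ < p.1 := by
      by_contra hc
      have h1 := D.g_left le_rfl
      rw [(hfg n₁ ⟨hb₁n.le, by linarith⟩).2] at h1
      rcases (not_lt.1 hc).eq_or_lt with h2 | h2
      · rw [← h2, hgp] at h1
        exact lt_irrefl _ h1
      · linarith [hpos n₁ h2]
    have hpn₂ : p.1 < n₂ := by
      by_contra hc
      have h1 := D.g_right le_rfl
      rw [(hfg n₂ ⟨by linarith, hnb₂.le⟩).2] at h1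
      rcases (not_lt.1 hc).eq_or_lt with h2 | h2
      · rw [h2, hgp] at h1
        exact lt_irrefl _ h1
      · linarith [hneg n₂ (by linarith) h2]
    -- The loop must lie over `(n₁, n₂)`, where the extended functions agree with `f` and `g`, and
    -- its height must stay below the energy cutoff.
    have hη : 0 < min (min (p.1 - n₁) (n₂ - p.1)) M :=
      lt_min (lt_min (by linarith) (by linarith)) D.M_pos
    obtain ⟨X, Y, t₀, t₁, t₂, m₁, m₂, m₁', A, A', hm, hm₁, hm₂, hnear⟩ :=
      hp.exists_loop hneg hpos hη
    have hXn : ∀ t ∈ Icc t₀ t₂, n₁ < X t ∧ X t < n₂ := by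
      intro t ht
      have h1 := abs_lt.1 (hnear t ht).1
      have h2 := min_le_left (min (p.1 - n₁) (n₂ - p.1)) M
      have h3 := min_le_left (p.1 - n₁) (n₂ - p.1)
      have h4 := min_le_right (p.1 - n₁) (n₂ - p.1)
      exact ⟨by linarith [h1.1], by linarith [h1.2]⟩
    have hXfg : ∀ t ∈ Icc t₀ t₂, f' (X t) = f (X t) ∧ g' (X t) = g (X t) := fun t ht =>
      hfg _ ⟨by linarith [(hXn t ht).1], by linarith [(hXn t ht).2]⟩
    obtain ⟨γ, T, hT, hper, hne, hγ⟩ := D.exists_periodic (xs := p.1)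
      (fun x hx => by
        rcases le_or_gt x n₁ with h | h
        · exact D.g_left h
        · rw [(hfg x ⟨by linarith, by linarith⟩).2]
          exact hneg x (by linarith) hx)
      (fun x hx => by
        rcases le_or_gt n₂ x with h | h
        · exact D.g_right h
        · rw [(hfg x ⟨by linarith, by linarith⟩).2]
          exact hpos x hx)
      (A.congr fun t ht => hXfg t ⟨ht.1, ht.2.trans A'.lt.le⟩)
      (A'.congr (f' := fun x => f' (-x)) (g' := fun x => -g' (-x)) fun t ht => by
        have := hXfg t ⟨A.lt.le.trans ht.1, ht.2⟩
        simp only [neg_neg, this.1, this.2, and_self])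
      (fun t ht => by
        have := (hnear t ht).2.trans_le (min_le_right _ _)
        linarith [D.M_pos])
      (by
        have h1 := (hXn t₂ ⟨(A.lt.trans A'.lt).le, le_rfl⟩).1
        have h2 := A'.X_right
        simp only [neg_inj] at h2
        linarith)
      hm hm₁ hm₂
      (by
        have h1 := (hXn t₁ ⟨A.lt.le, A'.lt.le⟩).2
        have h2 := A.X_right
        linarith)
    refine ⟨γ, fun t _ => ⟨hab₁.trans_le (hγ t).1.1, ?_⟩, ⟨T, hT, hper⟩, hne⟩
    have h1 := (hγ t).2.hasDerivWithinAt (s := univ)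
    have h2 := hfg _ (hγ t).1
    rwa [show lienardField f' g' (γ t) = lienardField f g (γ t) by
      simp only [lienardField, h2.1, h2.2]] at h1
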